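/- Let $\mathcal H$ be a complex Hilbert space and $n\ge 0$ an integer. Let $\mathbf G=\mathbf G_n\mathcal H$ be the set of Hermitian projections of rank $n$ in $\mathcal B(\mathcal H)$, and identify $\mathrm T^*\mathbf G$ with the set of all (not necessarily Hermitian) projections $r=r^2$ of rank $n$ in $\mathcal B(\mathcal H)$; both are regarded as submanifolds of $\mathcal B(\mathcal H)$. For $r\in \mathrm T^*\mathbf G$ let $\pi(r)\in\mathbf G$ be the orthogonal projection onto the image of $r$. Write $J_xA=i[A,x]$. On $\mathrm T^*\mathbf G$ consider, for $A\in \mathrm T_r\mathrm T^*\mathbf G$, - $IA=iA$ and $JA=J_rA=i[A,r]$; - the almost complex structure $\hat J$ determined by the connection with horizontal lift $H_r(a)=[r,[\pi(r),a]]$, $a\in \mathrm T_{\pi(r)}\mathbf G$, that is, $\hat J H_r(a)=H_r(J_{\pi(r)}a)$ on horizontal vectors, and $\hat J$ is the complex structure of the fibres of $\pi$ on vertical vectors (the fibre through $r$ is a complex vector space with $c\cdot r=(1-c)\pi(r)+cr$, so $\hat JA=iA$ if $\pi_*A=0$). Equivalently, $\hat JA=H_r(J_{\pi(r)}\pi_*A)+i\,(A-H_r(\pi_*A))$.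 Let $\Phi:\mathrm T^*\mathbf G\to\mathbf G\times\mathbf G$, $\Phi(r)=(\pi(r),\pi(r^*))$. Then $\Phi$ is a smooth embedding with open and dense image, and $\mathbf G\times\mathbf G$ is compact if $\mathcal H$ is finite-dimensional. Moreover, with respect to $\Phi$: 1. $I$, $J$ and $\hat J$ extend to (integrable) complex structures on $\mathbf G\times\mathbf G$. The extensions are unique, even among all smooth fields of real-linear endomorphisms of the tangent spaces, and for $(A,B)\in \mathrm T_{(p,q)}(\mathbf G\times\mathbf G)$ they are given by $$I:\ (A,B)\mapsto(J_pA,\,-J_qB),\qquad J:\ (A,B)\mapsto(J_pA,\,J_qB),$$ $$\hat J:\ (A,B)\mapsto\big(J_pA,\,-J_qB+J_qA-J_q^2J_pA\big).$$ 2. The involution $r\mapsto r^*$ of $\mathrm T^*\mathbf G$ extends to a smooth involution of $\mathbf G\times\mathbf G$. 3. Both projections $\mathrm T^*\mathbf G\to\mathbf G$, $r\mapsto\pi(r)$ and $r\mapsto\pi(r^*)$, extend to smooth maps $\mathbf G\times\mathbf G\to\mathbf G$. -/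

import Mathlib

open scoped ContDiff

universe u v

section Submanifolds

/- Smooth geometry on subsets `M` of a real normed space `E`; it is applied to submanifolds. -/

variable {E : Type u} [NormedAddCommGroup E] [NormedSpace ℝ E]
  {F : Type v} [NormedAddCommGroup F] [NormedSpace ℝ F]

/-- The tangent vectors of `M ⊆ E` at `x`: velocities at time `0` of smooth curves in `M`
that start at `x`. -/
def tangentVectors (M : Set E) (x : E) : Set E :=
  {A | ∃ γ : ℝ → E, ContDiff ℝ ∞ γ ∧ (∀ t, γ t ∈ M) ∧ γ 0 = x ∧ deriv γ 0 = A}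

/-- A map is smooth on `M` if near each point of `M` it is the restriction to `M` of a smooth
map defined on an open subset of the ambient space. -/
def SmoothMapOn (f : E → F) (M : Set E) : Prop :=
  ∀ x ∈ M, ∃ U : Set E, IsOpen U ∧ x ∈ U ∧
    ∃ g : E → F, ContDiffOn ℝ ∞ g U ∧ ∀ y ∈ M ∩ U, f y = g y

/-- The tangent map of `f : M → F` at `x ∈ M`. For a map that is smooth on `M`, the value on
a tangent vector `A` of `M` is the velocity of `f ∘ γ`, for every curve `γ` in `M` with
velocity `A`. -/
noncomputable def pushforward (f : E → F) (M : Set E) (x A : E) : F :=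
  fderivWithin ℝ f M x A

/-- `J` restricts to a smooth field of (real linear) endomorphisms of the tangent spaces of
`M`. Only the values `J x A` with `x ∈ M` and `A` tangent to `M` at `x` matter. -/
structure IsSmoothEndField (M : Set E) (J : E → E → E) : Prop where
  mapsTo : ∀ x ∈ M, ∀ A ∈ tangentVectors M x, J x A ∈ tangentVectors M x
  smooth : ∀ x ∈ M, ∃ U : Set E, IsOpen U ∧ x ∈ U ∧
    ∃ L : E → E →L[ℝ] E, ContDiffOn ℝ ∞ L U ∧
      ∀ y ∈ M ∩ U, ∀ A ∈ tangentVectors M y, J y A = L y A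

/-- `J` is an (integrable) complex structure on `M`: a smooth almost complex structure such
that each point of `M` has a chart `φ`, with inverse `ψ`, from a relatively open neighbourhood
`M ∩ U` onto an open subset `V` of a complex Banach space, whose differential carries `J` to
multiplication by the imaginary unit. -/
structure IsComplexStructureOn (M : Set E) (J : E → E → E) : Prop where
  endField : IsSmoothEndField M J
  sq : ∀ x ∈ M, ∀ A ∈ tangentVectors M x, J x (J x A) = -A
  integrable : ∀ x ∈ M, ∃ (W : Type u) (_ : NormedAddCommGroup W) (_ : NormedSpace ℂ W)
    (_ : CompleteSpace W) (U : Set E) (V : Set W) (φ : E → W) (ψ : W → E),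
    IsOpen U ∧ x ∈ U ∧ IsOpen V ∧
    ContDiffOn ℝ ∞ φ U ∧ ContDiffOn ℝ ∞ ψ V ∧
    Set.MapsTo φ (M ∩ U) V ∧ Set.MapsTo ψ V (M ∩ U) ∧
    Set.LeftInvOn ψ φ (M ∩ U) ∧ Set.RightInvOn ψ φ V ∧
    ∀ y ∈ M ∩ U, ∀ A ∈ tangentVectors M y,
      fderiv ℝ φ y (J y A) = Complex.I • fderiv ℝ φ y A

/-- `f : M → N` is a smooth embedding with relatively open and dense image. -/
structure IsOpenDenseEmbedding (f : E → F) (M : Set E) (N : Set F) : Prop where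
  mapsTo : Set.MapsTo f M N
  smooth : SmoothMapOn f M
  smooth_inverse : ∃ g : F → E, SmoothMapOn g (f '' M) ∧ Set.LeftInvOn g f M
  image_open : ∃ U : Set F, IsOpen U ∧ f '' M = N ∩ U
  image_dense : N ⊆ closure (f '' M)

/-- The field of endomorphisms `K` on `N` extends the field `J` on `M`, where `M` is regarded
as a part of `N` through `f : M → N`. -/
def ExtendsField (f : E → F) (M : Set E) (J : E → E → E) (K : F → F → F) : Prop :=
  ∀ x ∈ M, ∀ A ∈ tangentVectors M x,
    pushforward f M x (J x A) = K (f x) (pushforward f M x A)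

/-- `K` is a complex structure on `N` that extends `J`, and it is the only smooth field of
endomorphisms of the tangent spaces of `N` that extends `J`. -/
structure IsComplexExtension (f : E → F) (M : Set E) (N : Set F)
    (J : E → E → E) (K : F → F → F) : Prop where
  complex : IsComplexStructureOn N K
  extends_field : ExtendsField f M J K
  unique : ∀ K' : F → F → F, IsSmoothEndField N K' → ExtendsField f M J K' →
    ∀ y ∈ N, ∀ B ∈ tangentVectors N y, K' y B = K y B

end Submanifolds

section Projections

variable {H : Type u} [NormedAddCommGroup H] [InnerProductSpace ℂ H] [CompleteSpace H]

/-- The cotangent bundle of the Grassmannian of rank `n`, identified with the space of all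
(not necessarily Hermitian) projections of rank `n` in the bounded operators. -/
def cotangentGrassmannian (H : Type u) [NormedAddCommGroup H] [InnerProductSpace ℂ H]
    (n : ℕ) : Set (H →L[ℂ] H) :=
  {r | r * r = r ∧ LinearMap.rank (r : H →ₗ[ℂ] H) = n}

/-- The Grassmannian of rank `n`, identified with the space of Hermitian projections of
rank `n`; it is the zero section of the cotangent bundle. -/
def grassmannian (H : Type u) [NormedAddCommGroup H] [InnerProductSpace ℂ H]
    [CompleteSpace H] (n : ℕ) : Set (H →L[ℂ] H) :=
  {p | p ∈ cotangentGrassmannian H n ∧ star p = p}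

/-- The bundle projection: the orthogonal projection onto the image of `r` (which is closed
if `r` is a projection, so that the closure only serves to have a total function). -/
noncomputable def bundleProj (r : H →L[ℂ] H) : H →L[ℂ] H :=
  (LinearMap.range (r : H →ₗ[ℂ] H)).topologicalClosure.starProjection

/-- The operator `J_x A = i[A, x]`. -/
noncomputable def opJ (x A : H →L[ℂ] H) : H →L[ℂ] H := Complex.I • ⁅A, x⁆

/-- The complex structure `I A = i A` on the cotangent bundle. -/
noncomputable def structI (_r A : H →L[ℂ] H) : H →L[ℂ] H := Complex.I • A

/-- The complex structure `J A = i[A, r]` at `r` on the cotangent bundle. -/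
noncomputable def structJ (r A : H →L[ℂ] H) : H →L[ℂ] H := opJ r A

/-- The connection of the bundle projection: the horizontal lift to `r` of a tangent vector
`a` of the Grassmannian at `bundleProj r`. -/
noncomputable def horizontalLift (r a : H →L[ℂ] H) : H →L[ℂ] H :=
  ⁅r, ⁅bundleProj r, a⁆⁆

/-- The almost complex structure determined by the connection: on horizontal vectors it is
the lift of the complex structure `J` of the Grassmannian, and on vertical vectors it is the
one of the fibres. The fibres are complex vector spaces with zero `bundleProj r` and with
`c • r = (1 - c) bundleProj r + c r`, so that on vertical vectors it is multiplication by `i`. -/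
noncomputable def structJhat (n : ℕ) (r A : H →L[ℂ] H) : H →L[ℂ] H :=
  let a := pushforward bundleProj (cotangentGrassmannian H n) r A
  horizontalLift r (opJ (bundleProj r) a) + Complex.I • (A - horizontalLift r a)

/-- The embedding `r ↦ (π(r), π(r*))` of the cotangent bundle. -/
noncomputable def compactificationMap (r : H →L[ℂ] H) : (H →L[ℂ] H) × (H →L[ℂ] H) :=
  (bundleProj r, bundleProj (star r))

/-- The field of endomorphisms `(A, B) ↦ (J_p A, - J_q B)` at `(p, q)`. -/
noncomputable def extI (x X : (H →L[ℂ] H) × (H →L[ℂ] H)) : (H →L[ℂ] H) × (H →L[ℂ] H) :=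
  (opJ x.1 X.1, -opJ x.2 X.2)

/-- The field of endomorphisms `(A, B) ↦ (J_p A, J_q B)` at `(p, q)`. -/
noncomputable def extJ (x X : (H →L[ℂ] H) × (H →L[ℂ] H)) : (H →L[ℂ] H) × (H →L[ℂ] H) :=
  (opJ x.1 X.1, opJ x.2 X.2)

/-- The field of endomorphisms `(A, B) ↦ (J_p A, - J_q B + J_q A - J_q² J_p A)` at `(p, q)`. -/
noncomputable def extJhat (x X : (H →L[ℂ] H) × (H →L[ℂ] H)) :
    (H →L[ℂ] H) × (H →L[ℂ] H) :=
  (opJ x.1 X.1, -opJ x.2 X.2 + opJ x.2 X.1 - opJ x.2 (opJ x.2 (opJ x.1 X.1)))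

end Projections

/-! A projection is determined by its range and its kernel, and a projection r with π(r) = p and
π(r*) = q is the one onto the range of p along the kernel of q: this is `Oblique p q r`. For
Hermitian p, q of rank n it exists exactly when p + q - 1 is invertible; the inverse is then r + r*
- 1, and r = p(p + q - 1)⁻¹. The relation is symmetric (`Oblique.swap`): p is in turn the projection
onto the range of r along the kernel of r*, so π(r) = r(r + r* - 1)⁻¹. Thus Φ and its inverse are
given by the same smooth algebraic formula, and the image of Φ is the open condition that p + q - 1
is a unit.

For density (`image_dense`), q is kept and the range of p is moved: if V, W are isometric frames of
p and q, the range of V + tW is complementary to the kernel of q as soon as W*V + t is invertible,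
hence for all small t ≠ 0.

The differential of π only sees the corner (1 - p)Ap, on which J_p is multiplication by i; on the
adjoint corner it is -i. Comparing corners gives the formulas for the three extended structures.
Since dΦ is onto the tangent spaces (`exists_pushforward_eq`), a continuous extension is forced on a
dense set, hence everywhere.

For integrability, let s be the projection onto the range of p along the kernel of p₀. The graph
coordinate s - p₀ is a holomorphic chart of (G, J). Exchanging the roles of range and kernel gives a
chart of (G, -J), and products of these settle I and J. For Ĵ, the horizontal lift is [[a, p], r],
an infinitesimal unitary conjugation which respects the splitting of H into the range S and the
kernel of p. So G × G, fibred over p by the kernels of q, carries the complex structure induced by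
the holomorphic bundle S ⊕ H/S, the kernel of p standing for the quotient H/S. A holomorphic frame
is g = s + (1 - p)(1 - p₀): s is holomorphic on S, and constant vectors of the kernel of p₀ give
holomorphic sections of H/S. Pulling the kernel of q back by g gives the fibre coordinate, and
`frame_velocity_identity` is the holomorphy. -/

/-! ### Algebra of idempotents with prescribed range and kernel -/

section ObliqueProjections

variable {R : Type*} [Ring R]

/-- `p` and `r` are idempotents with the same range. -/
structure SameRange (p r : R) : Prop where
  left : p * r = r
  right : r * p = p

/-- `r` is the idempotent whose range is that of `p` and whose kernel is that of `q`. -/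
structure Oblique (p q r : R) : Prop where
  range_left : p * r = r
  range_right : r * p = p
  ker_right : r * q = r
  ker_left : q * r = q

/-- The projection onto the range of `p` along the kernel of `q`, if there is one. -/
noncomputable def obliqueProj (p q : R) : R := p * Ring.inverse (p + q - 1)

namespace SameRange

lemma symm {p r : R} (h : SameRange p r) : SameRange r p := ⟨h.right, h.left⟩

lemma idem {p r : R} (h : SameRange p r) : p * p = p := by
  have h1 := h.left
  have h2 := h.right
  linear_combination (norm := noncomm_ring) h1 * p + h2 - p * h2

lemma trans {p r s : R} (h : SameRange p r) (h' : SameRange r s) : SameRange p s :=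
  ⟨by rw [← h'.left, ← mul_assoc, h.left], by rw [← h.right, ← mul_assoc, h'.right]⟩

/-- Equal ranges give p'p = p and pp' = p'. For Hermitian idempotents these two equations are
adjoint to each other. -/
lemma unique [StarRing R] {p p' r : R} (h : SameRange p r) (h' : SameRange p' r)
    (hp : star p = p) (hp' : star p' = p') : p = p' := by
  have h1 : p' * p = p := (h'.trans h.symm).left
  have h2 : p * p' = p' := (h'.trans h.symm).right
  rw [← hp, ← h1, star_mul, hp, hp', h2]

end SameRange

namespace Oblique

variable {p q r r' : R}

lemma sameRange (h : Oblique p q r) : SameRange p r := ⟨h.range_left, h.range_right⟩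

lemma idem (h : Oblique p q r) : r * r = r := h.sameRange.symm.idem

lemma adjoint [StarRing R] (h : Oblique p q r) : Oblique (star q) (star p) (star r) :=
  ⟨by rw [← star_mul, h.ker_right], by rw [← star_mul, h.ker_left],
    by rw [← star_mul, h.range_left], by rw [← star_mul, h.range_right]⟩

lemma mul_eq_one (h : Oblique p q r) (h' : Oblique q p r') :
    (p + q - 1) * (r + r' - 1) = 1 := by
  linear_combination (norm := noncomm_ring) h.range_left + h.ker_left + h'.range_left + h'.ker_left

lemma mul_eq_one' (h : Oblique p q r) (h' : Oblique q p r') :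
    (r + r' - 1) * (p + q - 1) = 1 := by
  linear_combination (norm := noncomm_ring)
    h.range_right + h.ker_right + h'.range_right + h'.ker_right

lemma isUnit (h : Oblique p q r) (h' : Oblique q p r') : IsUnit (p + q - 1) :=
  ⟨⟨_, _, h.mul_eq_one h', h.mul_eq_one' h'⟩, rfl⟩

lemma inverse_eq (h : Oblique p q r) (h' : Oblique q p r') :
    Ring.inverse (p + q - 1) = r + r' - 1 :=
  Ring.inverse_unit ⟨_, _, h.mul_eq_one h', h.mul_eq_one' h'⟩

lemma obliqueProj_eq (h : Oblique p q r) (h' : Oblique q p r') : obliqueProj p q = r := by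
  rw [obliqueProj, h.inverse_eq h']
  linear_combination (norm := noncomm_ring) h.range_left + h'.ker_left

/-- The graph relation is symmetric: `p` has the range of `r` and the kernel of `r'`. -/
lemma swap (h : Oblique p q r) (h' : Oblique q p r') : Oblique r r' p :=
  ⟨h.range_right, h.range_left, h'.ker_left, h'.ker_right⟩

end Oblique

/-- The element w = p + q - 1 intertwines the two idempotents, qw = qp = wp. Hence pw⁻¹ = w⁻¹q, and
this element has the range of p by its first form and the kernel of q by its second. -/
lemma oblique_obliqueProj {p q : R} (hp : p * p = p) (hq : q * q = q)
    (hu : IsUnit (p + q - 1)) : Oblique p q (obliqueProj p q) := by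
  obtain ⟨w, hw⟩ := hu
  have e : obliqueProj p q = p * ↑w⁻¹ := by rw [obliqueProj, ← hw, Ring.inverse_unit]
  have h2 : q * (w : R) = w * p := by
    rw [hw]; linear_combination (norm := noncomm_ring) hq - hp
  have h3 : obliqueProj p q = ↑w⁻¹ * q := by
    rw [e, Units.eq_inv_mul_iff_mul_eq, ← mul_assoc, ← h2, Units.mul_inv_cancel_right]
  refine ⟨?_, ?_, ?_, ?_⟩
  · rw [e, ← mul_assoc, hp]
  · have : q * p = w * p := by rw [hw]; linear_combination (norm := noncomm_ring) -hp
    rw [h3, mul_assoc, this, Units.inv_mul_cancel_left]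
  · rw [h3, mul_assoc, hq]
  · have : q * p = q * w := by rw [hw]; linear_combination (norm := noncomm_ring) -hq
    rw [e, ← mul_assoc, this, Units.mul_inv_cancel_right]

/-- Multiplying the tangency condition by r on both sides gives 2rAr = rAr: tangent vectors are
off-diagonal with respect to r. -/
lemma mul_eq_zero_of_tangent {r A : R} (hr : r * r = r) (hA : A * r + r * A = A) :
    r * A * r = 0 := by
  linear_combination (norm := noncomm_ring) r * hA * r - r * A * hr - hr * A * r

end ObliqueProjections

/-! ### Projections of rank n, the map Φ and its inverse -/

section Operators

variable {H : Type u} [NormedAddCommGroup H] [InnerProductSpace ℂ H]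

lemma rank_mul_le_left (f g : H →L[ℂ] H) :
    LinearMap.rank ((f * g : H →L[ℂ] H) : H →ₗ[ℂ] H) ≤ LinearMap.rank (f : H →ₗ[ℂ] H) :=
  LinearMap.rank_comp_le_left (g : H →ₗ[ℂ] H) (f : H →ₗ[ℂ] H)

lemma rank_mul_le_right (f g : H →L[ℂ] H) :
    LinearMap.rank ((f * g : H →L[ℂ] H) : H →ₗ[ℂ] H) ≤ LinearMap.rank (g : H →ₗ[ℂ] H) :=
  LinearMap.rank_comp_le_right (g : H →ₗ[ℂ] H) (f : H →ₗ[ℂ] H)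

lemma SameRange.rank_eq {p r : H →L[ℂ] H} (h : SameRange p r) :
    LinearMap.rank (p : H →ₗ[ℂ] H) = LinearMap.rank (r : H →ₗ[ℂ] H) := by
  apply le_antisymm
  · conv_lhs => rw [← h.right]
    exact rank_mul_le_left _ _
  · conv_lhs => rw [← h.left]
    exact rank_mul_le_left _ _

lemma Oblique.rank_eq {p q r : H →L[ℂ] H} (h : Oblique p q r) :
    LinearMap.rank (q : H →ₗ[ℂ] H) = LinearMap.rank (r : H →ₗ[ℂ] H) := by
  apply le_antisymm
  · conv_lhs => rw [← h.ker_left]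
    exact rank_mul_le_right _ _
  · conv_lhs => rw [← h.ker_right]
    exact rank_mul_le_right _ _

lemma rank_conj {g g' r : H →L[ℂ] H} (h : g' * g = 1) :
    LinearMap.rank ((g * r * g' : H →L[ℂ] H) : H →ₗ[ℂ] H) = LinearMap.rank (r : H →ₗ[ℂ] H) := by
  apply le_antisymm
  · exact (rank_mul_le_left _ _).trans (rank_mul_le_right _ _)
  · have : r = g' * (g * r * g') * g := by
      linear_combination (norm := noncomm_ring) -(h * r * g' * g) - r * h
    conv_lhs => rw [this]
    exact (rank_mul_le_left _ _).trans (rank_mul_le_right _ _)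

lemma conj_mem_cotangentGrassmannian {n : ℕ} {g g' r : H →L[ℂ] H} (h : g' * g = 1)
    (hr : r ∈ cotangentGrassmannian H n) : g * r * g' ∈ cotangentGrassmannian H n := by
  refine ⟨?_, (rank_conj h).trans hr.2⟩
  linear_combination (norm := noncomm_ring) g * r * h * r * g' + g * hr.1 * g'

variable [CompleteSpace H]

lemma star_bundleProj (r : H →L[ℂ] H) : star (bundleProj r) = bundleProj r :=
  (isSelfAdjoint_starProjection _).star_eq

lemma sameRange_bundleProj {r : H →L[ℂ] H} (hr : r * r = r) : SameRange (bundleProj r) r := by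
  have hc : IsClosed ((LinearMap.range (r : H →ₗ[ℂ] H) : Submodule ℂ H) : Set H) :=
    ContinuousLinearMap.IsIdempotentElem.isClosed_range hr
  have hK : (LinearMap.range (r : H →ₗ[ℂ] H)).topologicalClosure = LinearMap.range (r : H →ₗ[ℂ] H) :=
    hc.submodule_topologicalClosure_eq
  constructor
  · ext x
    exact Submodule.starProjection_eq_self_iff.2
      (Submodule.le_topologicalClosure _ (LinearMap.mem_range_self _ x))
  · ext x
    have h : bundleProj r x ∈ LinearMap.range (r : H →ₗ[ℂ] H) := by
      rw [← hK]
      exact Submodule.starProjection_apply_mem _ x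
    obtain ⟨y, hy⟩ := h
    have hy : r y = bundleProj r x := hy
    rw [mul_apply_eq_comp, ← hy, ← mul_apply_eq_comp, hr]

lemma bundleProj_eq {p r : H →L[ℂ] H} (hp : star p = p) (h : SameRange p r) : bundleProj r = p :=
  (sameRange_bundleProj h.symm.idem).unique h (star_bundleProj r) hp

lemma bundleProj_congr {r s : H →L[ℂ] H} (h : SameRange r s) : bundleProj r = bundleProj s :=
  bundleProj_eq (star_bundleProj s) ((sameRange_bundleProj h.symm.idem).trans h.symm)

lemma star_idem {r : H →L[ℂ] H} (hr : r * r = r) : star r * star r = star r := by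
  rw [← star_mul, hr]

lemma oblique_bundleProj {r : H →L[ℂ] H} (hr : r * r = r) :
    Oblique (bundleProj r) (bundleProj (star r)) r := by
  have h1 := sameRange_bundleProj hr
  have h2 := sameRange_bundleProj (star_idem hr)
  refine ⟨h1.left, h1.right, ?_, ?_⟩
  · rw [← star_star (r * _), star_mul, star_bundleProj, h2.left, star_star]
  · rw [← star_star (_ * r), star_mul, star_bundleProj, h2.right, star_bundleProj]

lemma oblique_star_bundleProj {r : H →L[ℂ] H} (hr : r * r = r) :
    Oblique (bundleProj (star r)) (bundleProj r) (star r) := by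
  simpa using oblique_bundleProj (star_idem hr)

lemma Oblique.star_of_star_eq {p q r : H →L[ℂ] H} (h : Oblique p q r) (hp : star p = p)
    (hq : star q = q) : Oblique q p (star r) := by
  simpa [hp, hq] using h.adjoint

/-- The bundle projection as an algebraic function. -/
lemma bundleProj_eq_obliqueProj {r : H →L[ℂ] H} (hr : r * r = r) :
    bundleProj r = obliqueProj r (star r) :=
  (((oblique_bundleProj hr).swap (oblique_star_bundleProj hr)).obliqueProj_eq
    ((oblique_star_bundleProj hr).swap (oblique_bundleProj hr))).symm

lemma isUnit_add_star_sub_one {r : H →L[ℂ] H} (hr : r * r = r) : IsUnit (r + star r - 1) :=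
  ((oblique_bundleProj hr).swap (oblique_star_bundleProj hr)).isUnit
    ((oblique_star_bundleProj hr).swap (oblique_bundleProj hr))

lemma Oblique.compactificationMap_eq {p q r : H →L[ℂ] H} (h : Oblique p q r) (hp : star p = p)
    (hq : star q = q) : compactificationMap r = (p, q) :=
  Prod.ext (bundleProj_eq hp h.sameRange)
    (bundleProj_eq hq (h.star_of_star_eq hp hq).sameRange)

lemma bundleProj_mem {n : ℕ} {r : H →L[ℂ] H} (hr : r ∈ cotangentGrassmannian H n) :
    bundleProj r ∈ grassmannian H n := by
  have h := sameRange_bundleProj hr.1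
  exact ⟨⟨h.idem, h.rank_eq.trans hr.2⟩, star_bundleProj r⟩

/-- The rank of r* is found through π(r*), which has the same range as r* and the same kernel as r.
-/
lemma star_mem_cotangentGrassmannian {n : ℕ} {r : H →L[ℂ] H} (hr : r ∈ cotangentGrassmannian H n) :
    star r ∈ cotangentGrassmannian H n := by
  refine ⟨star_idem hr.1, ?_⟩
  rw [← (sameRange_bundleProj (star_idem hr.1)).rank_eq, (oblique_bundleProj hr.1).rank_eq, hr.2]

lemma Oblique.mem {n : ℕ} {p q r : H →L[ℂ] H} (h : Oblique p q r) (hp : p ∈ grassmannian H n) :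
    r ∈ cotangentGrassmannian H n :=
  ⟨h.idem, by rw [← h.sameRange.rank_eq, hp.1.2]⟩

lemma compactificationMap_mem {n : ℕ} {r : H →L[ℂ] H} (hr : r ∈ cotangentGrassmannian H n) :
    compactificationMap r ∈ grassmannian H n ×ˢ grassmannian H n :=
  ⟨bundleProj_mem hr, bundleProj_mem (star_mem_cotangentGrassmannian hr)⟩

lemma obliqueProj_compactificationMap {r : H →L[ℂ] H} (hr : r * r = r) :
    obliqueProj (compactificationMap r).1 (compactificationMap r).2 = r :=
  (oblique_bundleProj hr).obliqueProj_eq (oblique_star_bundleProj hr)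

lemma oblique_of_mem {n : ℕ} {p q : H →L[ℂ] H} (hp : p ∈ grassmannian H n)
    (hq : q ∈ grassmannian H n) (hu : IsUnit (p + q - 1)) : Oblique p q (obliqueProj p q) :=
  oblique_obliqueProj hp.1.1 hq.1.1 hu

lemma compactificationMap_obliqueProj {n : ℕ} {p q : H →L[ℂ] H} (hp : p ∈ grassmannian H n)
    (hq : q ∈ grassmannian H n) (hu : IsUnit (p + q - 1)) :
    compactificationMap (obliqueProj p q) = (p, q) :=
  (oblique_of_mem hp hq hu).compactificationMap_eq hp.2 hq.2

/-- The image of the compactification map. -/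
lemma image_compactificationMap (n : ℕ) :
    compactificationMap '' (cotangentGrassmannian H n) =
      (grassmannian H n ×ˢ grassmannian H n) ∩ {x | IsUnit (x.1 + x.2 - 1)} := by
  ext ⟨p, q⟩
  constructor
  · rintro ⟨r, hr, h⟩
    rw [← h]
    exact ⟨compactificationMap_mem hr,
      (oblique_bundleProj hr.1).isUnit (oblique_star_bundleProj hr.1)⟩
  · rintro ⟨⟨hp, hq⟩, hu⟩
    exact ⟨_, (oblique_of_mem hp hq hu).mem hp, compactificationMap_obliqueProj hp hq hu⟩

lemma isOpen_isUnit_add_sub_one :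
    IsOpen {x : (H →L[ℂ] H) × (H →L[ℂ] H) | IsUnit (x.1 + x.2 - 1)} :=
  Units.isOpen.preimage (by fun_prop : Continuous fun x : (H →L[ℂ] H) × (H →L[ℂ] H) =>
    x.1 + x.2 - 1)

lemma contDiffAt_obliqueProj {x : (H →L[ℂ] H) × (H →L[ℂ] H)} (hx : IsUnit (x.1 + x.2 - 1)) :
    ContDiffAt ℝ ∞ (fun x : (H →L[ℂ] H) × (H →L[ℂ] H) => obliqueProj x.1 x.2) x := by
  unfold obliqueProj
  obtain ⟨w, hw⟩ := hx
  have h : ContDiffAt ℝ ∞ Ring.inverse (x.1 + x.2 - 1) := hw ▸ contDiffAt_ringInverse ℝ w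
  have h2 : ContDiff ℝ ∞ (fun x : (H →L[ℂ] H) × (H →L[ℂ] H) => x.1 + x.2 - 1) := by fun_prop
  exact contDiffAt_fst.mul (ContDiffAt.comp x (g := Ring.inverse) (f := fun x : (H →L[ℂ] H) × (H →L[ℂ] H) => x.1 + x.2 - 1)
    h h2.contDiffAt)

lemma contDiff_star : ContDiff ℝ ∞ (fun r : H →L[ℂ] H => star r) :=
  (starL' ℝ : (H →L[ℂ] H) ≃L[ℝ] (H →L[ℂ] H)).contDiff

lemma smoothMapOn_of_contDiffAt {E : Type u} [NormedAddCommGroup E] [NormedSpace ℝ E]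
    {F : Type v} [NormedAddCommGroup F] [NormedSpace ℝ F] {f g : E → F} {M : Set E}
    {U : Set E} (hU : IsOpen U) (hMU : M ⊆ U)
    (hg : ∀ x ∈ U, ContDiffAt ℝ ∞ g x) (h : ∀ x ∈ M, f x = g x) : SmoothMapOn f M := fun _ hx =>
  ⟨U, hU, hMU hx, g, fun y hy => (hg y hy).contDiffWithinAt, fun y hy => h y hy.1⟩

lemma isOpen_isUnit_add_star_sub_one : IsOpen {r : H →L[ℂ] H | IsUnit (r + star r - 1)} :=
  Units.isOpen.preimage (by fun_prop : Continuous fun r : H →L[ℂ] H => r + star r - 1)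

lemma contDiffAt_obliqueProj_star_of_isUnit {r : H →L[ℂ] H} (hr : IsUnit (r + star r - 1)) :
    ContDiffAt ℝ ∞ (fun r : H →L[ℂ] H => obliqueProj r (star r)) r :=
  ContDiffAt.comp r (g := fun x : (H →L[ℂ] H) × (H →L[ℂ] H) => obliqueProj x.1 x.2)
    (f := fun r => (r, star r)) (contDiffAt_obliqueProj hr)
    (contDiff_id.prodMk contDiff_star).contDiffAt

/-- The formula r(r + r* - 1)⁻¹ makes sense and is smooth on an open set of operators containing all
projections, and there it serves as the smooth ambient extension of π. -/
lemma smoothMapOn_bundleProj (n : ℕ) :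
    SmoothMapOn (bundleProj (H := H)) (cotangentGrassmannian H n) :=
  smoothMapOn_of_contDiffAt isOpen_isUnit_add_star_sub_one
    (fun _ hr => isUnit_add_star_sub_one hr.1)
    (fun _ hr => contDiffAt_obliqueProj_star_of_isUnit hr)
    (fun _ hr => bundleProj_eq_obliqueProj hr.1)

lemma smoothMapOn_compactificationMap (n : ℕ) :
    SmoothMapOn (compactificationMap (H := H)) (cotangentGrassmannian H n) :=
  smoothMapOn_of_contDiffAt
    (g := fun r : H →L[ℂ] H => (obliqueProj r (star r), obliqueProj (star r) r))
    isOpen_isUnit_add_star_sub_one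
    (fun _ hr => isUnit_add_star_sub_one hr.1)
    (fun r hr => (contDiffAt_obliqueProj_star_of_isUnit hr).prodMk
      (ContDiffAt.comp r (g := fun x : (H →L[ℂ] H) × (H →L[ℂ] H) => obliqueProj x.1 x.2)
        (f := fun r => (star r, r)) (contDiffAt_obliqueProj (by simpa [add_comm] using hr))
        (contDiff_star.prodMk contDiff_id).contDiffAt))
    (fun r hr => Prod.ext (bundleProj_eq_obliqueProj hr.1)
      ((bundleProj_eq_obliqueProj (star_idem hr.1)).trans (by rw [star_star])))

lemma smoothMapOn_obliqueProj (n : ℕ) :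
    SmoothMapOn (fun x : (H →L[ℂ] H) × (H →L[ℂ] H) => obliqueProj x.1 x.2)
      (compactificationMap '' (cotangentGrassmannian H n)) := by
  rw [image_compactificationMap]
  exact smoothMapOn_of_contDiffAt isOpen_isUnit_add_sub_one Set.inter_subset_right
    (fun _ hx => contDiffAt_obliqueProj hx) (fun _ _ => rfl)

end Operators

/-! ### Differentiation along curves -/

section Curves

variable {E : Type u} [NormedAddCommGroup E] [NormedSpace ℝ E]
  {F : Type v} [NormedAddCommGroup F] [NormedSpace ℝ F]

lemma SmoothMapOn.differentiableWithinAt {f : E → F} {M : Set E} (hf : SmoothMapOn f M) {x : E}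
    (hx : x ∈ M) : DifferentiableWithinAt ℝ f M x := by
  obtain ⟨U, hU, hxU, g, hg, hfg⟩ := hf x hx
  have h1 : DifferentiableWithinAt ℝ g M x :=
    ((hg.differentiableOn (by simp) x hxU).differentiableAt (hU.mem_nhds hxU)).differentiableWithinAt
  refine h1.congr_of_eventuallyEq ?_ (hfg x ⟨hx, hxU⟩)
  filter_upwards [self_mem_nhdsWithin, mem_nhdsWithin_of_mem_nhds (hU.mem_nhds hxU)] with y hy hy'
  exact hfg y ⟨hy, hy'⟩

/-- The tangent map sends the velocity of a curve to the velocity of its image. -/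
lemma SmoothMapOn.hasDerivAt_comp {f : E → F} {M : Set E} (hf : SmoothMapOn f M) {γ : ℝ → E}
    (hγ : ContDiff ℝ ∞ γ) (hM : ∀ t, γ t ∈ M) :
    HasDerivAt (fun t => f (γ t)) (pushforward f M (γ 0) (deriv γ 0)) 0 :=
  -- The derivative within `M` need not be unique as a linear map on the ambient space, but the
  -- chain rule along a curve in `M` holds for any choice, so its value on velocities is determined.
  (hf.differentiableWithinAt (hM 0)).hasFDerivWithinAt.comp_hasDerivAt 0
    (hγ.differentiable (by simp) 0).hasDerivAt (Filter.Eventually.of_forall hM)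

end Curves

/-! ### Tangent spaces and the differential of the bundle projection -/

section Tangents

variable {H : Type u} [NormedAddCommGroup H] [InnerProductSpace ℂ H] [CompleteSpace H]

lemma exp_neg_mul_exp (X : H →L[ℂ] H) : NormedSpace.exp (-X) * NormedSpace.exp X = 1 := by
  let : NormedAlgebra ℚ (H →L[ℂ] H) := NormedAlgebra.restrictScalars ℚ ℝ _
  rw [← NormedSpace.exp_add_of_commute (Commute.neg_left rfl), neg_add_cancel, NormedSpace.exp_zero]

lemma contDiff_exp : ContDiff ℝ ∞ (NormedSpace.exp : (H →L[ℂ] H) → _) :=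
  contDiff_iff_contDiffAt.2 fun x => (NormedSpace.exp_analytic (𝕂 := ℝ) x).contDiffAt

/-- The conjugates of `r` under a one-parameter group. -/
noncomputable def conjCurve (X r : H →L[ℂ] H) (t : ℝ) : H →L[ℂ] H :=
  NormedSpace.exp (t • X) * r * NormedSpace.exp (-(t • X))

lemma conjCurve_zero (X r : H →L[ℂ] H) : conjCurve X r 0 = r := by
  simp [conjCurve]

lemma contDiff_conjCurve (X r : H →L[ℂ] H) : ContDiff ℝ ∞ (conjCurve X r) := by
  have h1 : ContDiff ℝ ∞ (fun t : ℝ => NormedSpace.exp (t • X)) :=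
    contDiff_exp.comp (contDiff_id.smul contDiff_const)
  have h2 : ContDiff ℝ ∞ (fun t : ℝ => NormedSpace.exp (-(t • X))) :=
    contDiff_exp.comp (contDiff_id.smul contDiff_const).neg
  exact (h1.mul contDiff_const).mul h2

lemma deriv_conjCurve (X r : H →L[ℂ] H) : deriv (conjCurve X r) 0 = X * r - r * X := by
  have h1 := hasDerivAt_exp_smul_const (𝕂 := ℝ) X 0
  have h2 := hasDerivAt_exp_smul_const (𝕂 := ℝ) (-X) 0
  have h3 := ((h1.mul (hasDerivAt_const (0 : ℝ) r)).mul h2).deriv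
  have e : conjCurve X r = (fun u : ℝ => NormedSpace.exp (u • X)) * (fun _ => r) *
      (fun u : ℝ => NormedSpace.exp (u • -X)) := by
    ext1 t; simp [conjCurve]
  rw [e, h3]
  simp [sub_eq_add_neg]

lemma conjCurve_mem {n : ℕ} {r : H →L[ℂ] H} (hr : r ∈ cotangentGrassmannian H n) (X : H →L[ℂ] H)
    (t : ℝ) : conjCurve X r t ∈ cotangentGrassmannian H n :=
  conj_mem_cotangentGrassmannian (exp_neg_mul_exp _) hr

lemma star_conjCurve {X r : H →L[ℂ] H} (hX : star X = -X) (hr : star r = r) (t : ℝ) :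
    star (conjCurve X r t) = conjCurve X r t := by
  simp [conjCurve, NormedSpace.star_exp, hX, hr, mul_assoc]

lemma mem_tangentVectors_cotangentGrassmannian {n : ℕ} {r : H →L[ℂ] H}
    (hr : r ∈ cotangentGrassmannian H n) {A : H →L[ℂ] H} :
    A ∈ tangentVectors (cotangentGrassmannian H n) r ↔ A * r + r * A = A := by
  constructor
  · rintro ⟨γ, hγ, hM, rfl, rfl⟩
    have h := (hγ.differentiable (by simp) 0).hasDerivAt
    exact (h.mul h).unique (h.congr_of_eventuallyEq (Filter.Eventually.of_forall fun t => (hM t).1))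
  · intro hA
    -- Conjugation by exp(tX) stays among the projections and has velocity [X, r]. With X = [A, r]
    -- this is Ar + rA - 2rAr = A.
    refine ⟨conjCurve (A * r - r * A) r, contDiff_conjCurve _ _, conjCurve_mem hr _,
      conjCurve_zero _ _, ?_⟩
    rw [deriv_conjCurve]
    linear_combination (norm := noncomm_ring) A * hr.1 + hr.1 * A + hA
      - (2 : ℤ) • mul_eq_zero_of_tangent hr.1 hA

lemma hasDerivAt_star {γ : ℝ → H →L[ℂ] H} {A : H →L[ℂ] H} {t : ℝ} (h : HasDerivAt γ A t) :
    HasDerivAt (fun t => star (γ t)) (star A) t :=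
  (starL' ℝ : (H →L[ℂ] H) ≃L[ℝ] (H →L[ℂ] H)).toContinuousLinearMap.hasFDerivAt.comp_hasDerivAt t h

lemma mem_tangentVectors_grassmannian {n : ℕ} {p : H →L[ℂ] H}
    (hp : p ∈ grassmannian H n) {A : H →L[ℂ] H} :
    A ∈ tangentVectors (grassmannian H n) p ↔ A * p + p * A = A ∧ star A = A := by
  constructor
  · rintro ⟨γ, hγ, hM, rfl, rfl⟩
    have h := (hγ.differentiable (by simp) 0).hasDerivAt
    exact ⟨(h.mul h).unique (h.congr_of_eventuallyEq
      (Filter.Eventually.of_forall fun t => (hM t).1.1)),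
      (hasDerivAt_star h).unique (h.congr_of_eventuallyEq
      (Filter.Eventually.of_forall fun t => (hM t).2))⟩
  · rintro ⟨hA, hs⟩
    -- For Hermitian A and p the commutator [A, p] is skew-Hermitian, so the conjugation is unitary
    -- and the curve stays Hermitian.
    refine ⟨conjCurve (A * p - p * A) p, contDiff_conjCurve _ _, fun t => ⟨conjCurve_mem hp.1 _ t,
      star_conjCurve (by simp [hs, hp.2]) hp.2 t⟩,
      conjCurve_zero _ _, ?_⟩
    rw [deriv_conjCurve]
    linear_combination (norm := noncomm_ring) A * hp.1.1 + hp.1.1 * A + hA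
      - (2 : ℤ) • mul_eq_zero_of_tangent hp.1.1 hA

lemma mem_tangentVectors_prod {E : Type u} [NormedAddCommGroup E] [NormedSpace ℝ E]
    {F : Type v} [NormedAddCommGroup F] [NormedSpace ℝ F] {M : Set E} {N : Set F} {x X : E × F} :
    X ∈ tangentVectors (M ×ˢ N) x ↔ X.1 ∈ tangentVectors M x.1 ∧ X.2 ∈ tangentVectors N x.2 := by
  constructor
  · rintro ⟨γ, hγ, hM, rfl, rfl⟩
    have h := (hγ.differentiable (by simp) 0).hasDerivAt
    exact ⟨⟨fun t => (γ t).1, contDiff_fst.comp hγ, fun t => (hM t).1, rfl,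
      ((hasFDerivAt_fst (𝕜 := ℝ) (p := γ 0)).comp_hasDerivAt 0 h).deriv⟩,
      ⟨fun t => (γ t).2, contDiff_snd.comp hγ, fun t => (hM t).2, rfl,
      ((hasFDerivAt_snd (𝕜 := ℝ) (p := γ 0)).comp_hasDerivAt 0 h).deriv⟩⟩
  · obtain ⟨x1, x2⟩ := x
    obtain ⟨X1, X2⟩ := X
    rintro ⟨⟨γ, hγ, hM, rfl, rfl⟩, ⟨δ, hδ, hN, rfl, rfl⟩⟩
    exact ⟨fun t => (γ t, δ t), hγ.prodMk hδ, fun t => ⟨hM t, hN t⟩, rfl,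
      ((hγ.differentiable (by simp) 0).hasDerivAt.prodMk
        (hδ.differentiable (by simp) 0).hasDerivAt).deriv⟩

lemma mem_tangentVectors_grassmannian_prod {n : ℕ} {x X : (H →L[ℂ] H) × (H →L[ℂ] H)}
    (hx : x ∈ grassmannian H n ×ˢ grassmannian H n) :
    X ∈ tangentVectors (grassmannian H n ×ˢ grassmannian H n) x ↔
      (X.1 * x.1 + x.1 * X.1 = X.1 ∧ star X.1 = X.1) ∧
      (X.2 * x.2 + x.2 * X.2 = X.2 ∧ star X.2 = X.2) := by
  rw [mem_tangentVectors_prod, mem_tangentVectors_grassmannian hx.1,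
    mem_tangentVectors_grassmannian hx.2]

lemma pushforward_bundleProj {n : ℕ} {r A : H →L[ℂ] H}
    (hA : A ∈ tangentVectors (cotangentGrassmannian H n) r) :
    pushforward bundleProj (cotangentGrassmannian H n) r A =
      (1 - bundleProj r) * A * bundleProj r + star ((1 - bundleProj r) * A * bundleProj r) := by
  obtain ⟨γ, hγ, hM, rfl, rfl⟩ := hA
  have h := (hγ.differentiable (by simp) 0).hasDerivAt
  have hπ := (smoothMapOn_bundleProj n).hasDerivAt_comp hγ hM
  set a := pushforward bundleProj (cotangentGrassmannian H n) (γ 0) (deriv γ 0)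
  set A := deriv γ 0
  have e : ∀ t, SameRange (bundleProj (γ t)) (γ t) := fun t => sameRange_bundleProj (hM t).1
  have e1 := (hπ.mul h).unique (h.congr_of_eventuallyEq (.of_forall fun t => (e t).left))
  have e2 := (h.mul hπ).unique (hπ.congr_of_eventuallyEq (.of_forall fun t => (e t).right))
  have e3 := (hπ.mul hπ).unique (hπ.congr_of_eventuallyEq (.of_forall fun t => (e t).idem))
  have e4 := (hasDerivAt_star hπ).unique
    (hπ.congr_of_eventuallyEq (.of_forall fun t => star_bundleProj _))
  have hs := star_bundleProj (γ 0)
  have e0 := e 0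
  set p := bundleProj (γ 0)
  set r := γ 0
  -- Differentiating rp = p gives Ap + ra = a, and 1 - p kills r; the corner of A is therefore that
  -- of a. The other half of a is its adjoint, because a is Hermitian.
  have k1 : (1 - p) * A * p = a * p := by
    linear_combination (norm := noncomm_ring) (1 - p) * e2 + e0.left * a - e3
  have k2 : star ((1 - p) * A * p) = p * a := by
    rw [k1, star_mul, e4, hs]
  rw [k2, k1, e3]

lemma pushforward_compactificationMap {n : ℕ} {r A : H →L[ℂ] H}
    (hA : A ∈ tangentVectors (cotangentGrassmannian H n) r) :
    pushforward compactificationMap (cotangentGrassmannian H n) r A =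
      (pushforward bundleProj (cotangentGrassmannian H n) r A,
       pushforward bundleProj (cotangentGrassmannian H n) (star r) (star A)) := by
  obtain ⟨γ, hγ, hM, rfl, rfl⟩ := hA
  have h := (hγ.differentiable (by simp) 0).hasDerivAt
  have h1 := (smoothMapOn_bundleProj n).hasDerivAt_comp hγ hM
  have h2 := (smoothMapOn_bundleProj n).hasDerivAt_comp (contDiff_star.comp hγ)
    (fun t => star_mem_cotangentGrassmannian (hM t))
  have h3 := (smoothMapOn_compactificationMap n).hasDerivAt_comp hγ hM
  have h4 : deriv ((fun r : H →L[ℂ] H => star r) ∘ γ) 0 = star (deriv γ 0) :=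
    (hasDerivAt_star h).deriv
  rw [h4] at h2
  exact h3.unique (h1.prodMk h2)

end Tangents

/-! ### The three structures transported by dΦ -/

section Fields

variable {H : Type u} [NormedAddCommGroup H] [InnerProductSpace ℂ H]

lemma opJ_eq (x A : H →L[ℂ] H) : opJ x A = Complex.I • (A * x - x * A) := rfl

lemma opJ_add (x A B : H →L[ℂ] H) : opJ x (A + B) = opJ x A + opJ x B := by
  simp only [opJ_eq, add_mul, mul_add, ← smul_add]
  congr 1
  abel

lemma opJ_neg (x A : H →L[ℂ] H) : opJ x (-A) = -opJ x A := by
  simp only [opJ_eq, neg_mul, mul_neg, ← smul_neg]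
  congr 1
  abel

lemma opJ_sub (x A B : H →L[ℂ] H) : opJ x (A - B) = opJ x A - opJ x B := by
  rw [sub_eq_add_neg, opJ_add, opJ_neg, sub_eq_add_neg]

lemma opJ_opJ (x y A : H →L[ℂ] H) :
    opJ x (opJ y A) = -((A * y - y * A) * x - x * (A * y - y * A)) := by
  simp only [opJ_eq, smul_mul_assoc, mul_smul_comm, ← smul_sub, smul_smul, Complex.I_mul_I,
    neg_one_smul]

lemma opJ_tangent {p : H →L[ℂ] H} (hp : p * p = p) (A : H →L[ℂ] H) :
    opJ p A * p + p * opJ p A = opJ p A := by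
  simp only [opJ_eq, smul_mul_assoc, mul_smul_comm, ← smul_add]
  congr 1
  linear_combination (norm := noncomm_ring) A * hp - hp * A

lemma opJ_opJ_of_tangent {p A : H →L[ℂ] H} (hp : p * p = p) (hA : A * p + p * A = A) :
    opJ p (opJ p A) = -A := by
  rw [opJ_opJ]
  linear_combination (norm := noncomm_ring) - A * hp - hp * A - hA
      + (2 : ℤ) • mul_eq_zero_of_tangent hp hA

lemma opJ_opJ_opJ {p : H →L[ℂ] H} (hp : p * p = p) (A : H →L[ℂ] H) :
    opJ p (opJ p (opJ p A)) = -opJ p A :=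
  opJ_opJ_of_tangent hp (opJ_tangent hp A)

lemma structJ_tangent {r : H →L[ℂ] H} (hr : r * r = r) (A : H →L[ℂ] H) :
    structJ r A * r + r * structJ r A = structJ r A := opJ_tangent hr A

lemma structI_tangent {r A : H →L[ℂ] H} (hA : A * r + r * A = A) :
    structI r A * r + r * structI r A = structI r A := by
  simp only [structI, smul_mul_assoc, mul_smul_comm, ← smul_add, hA]

lemma lie_tangent {r : H →L[ℂ] H} (hr : r * r = r) (c : H →L[ℂ] H) :
    ⁅r, c⁆ * r + r * ⁅r, c⁆ = ⁅r, c⁆ := by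
  simp only [Ring.lie_def]
  linear_combination (norm := noncomm_ring) - c * hr + hr * c

variable [CompleteSpace H]

lemma star_opJ {x A : H →L[ℂ] H} (hx : star x = x) (hA : star A = A) :
    star (opJ x A) = opJ x A := by
  simp only [opJ_eq, star_smul, star_sub, star_mul, hx, hA, Complex.star_def, Complex.conj_I,
    neg_smul, ← smul_neg, neg_sub]

lemma structJhat_tangent (n : ℕ) {r A : H →L[ℂ] H} (hr : r * r = r) (hA : A * r + r * A = A) :
    structJhat n r A * r + r * structJhat n r A = structJhat n r A := by
  simp only [structJhat, horizontalLift]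
  set a := pushforward bundleProj (cotangentGrassmannian H n) r A
  have h1 := lie_tangent hr ⁅bundleProj r, opJ (bundleProj r) a⁆
  have h2 := lie_tangent hr ⁅bundleProj r, a⁆
  simp only [add_mul, mul_add, smul_mul_assoc, mul_smul_comm]
  have h3 : (A - ⁅r, ⁅bundleProj r, a⁆⁆) * r + r * (A - ⁅r, ⁅bundleProj r, a⁆⁆) =
    A - ⁅r, ⁅bundleProj r, a⁆⁆ := by
    linear_combination (norm := noncomm_ring) hA - h2
  conv_rhs => rw [← h1, ← h3]
  rw [smul_add]
  abel

/-- The tangent vector at the orthogonal projection `p` that is determined by `A`: the tangent map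
of the bundle projection. -/
noncomputable def projTangent (p A : H →L[ℂ] H) : H →L[ℂ] H :=
  (1 - p) * A * p + star ((1 - p) * A * p)

lemma projTangent_add (p A B : H →L[ℂ] H) :
    projTangent p (A + B) = projTangent p A + projTangent p B := by
  simp only [projTangent, mul_add, add_mul, star_add]
  abel

lemma projTangent_neg (p A : H →L[ℂ] H) : projTangent p (-A) = -projTangent p A := by
  simp only [projTangent, mul_neg, neg_mul, star_neg]
  abel

lemma projTangent_sub (p A B : H →L[ℂ] H) :
    projTangent p (A - B) = projTangent p A - projTangent p B := by
  rw [sub_eq_add_neg, projTangent_add, projTangent_neg, sub_eq_add_neg]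

lemma star_projTangent (p A : H →L[ℂ] H) : star (projTangent p A) = projTangent p A := by
  rw [projTangent, star_add, star_star, add_comm]

lemma projTangent_tangent {p : H →L[ℂ] H} (hp : p * p = p) (hs : star p = p) (A : H →L[ℂ] H) :
    projTangent p A * p + p * projTangent p A = projTangent p A := by
  simp only [projTangent, star_mul, star_sub, star_one, hs]
  linear_combination (norm := noncomm_ring) (1 - p) * A * hp - hp * A * p
    - p * star A * hp + hp * star A * (1 - p)

lemma projTangent_congr {p A B : H →L[ℂ] H} (h : (1 - p) * A * p = (1 - p) * B * p) :
    projTangent p A = projTangent p B := by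
  rw [projTangent, projTangent, h]

/-- Both sides multiply the corner (1 - p)Ap by i and its adjoint by -i. -/
lemma projTangent_I_smul {p : H →L[ℂ] H} (hp : p * p = p) (hs : star p = p) (A : H →L[ℂ] H) :
    projTangent p (Complex.I • A) = opJ p (projTangent p A) := by
  simp only [projTangent, opJ_eq, smul_mul_assoc, mul_smul_comm, star_smul, Complex.star_def,
    Complex.conj_I, neg_smul, ← smul_neg, ← smul_add]
  congr 1
  simp only [star_mul, star_sub, star_one, hs]
  linear_combination (norm := noncomm_ring) - (1 - p) * A * hp - hp * A * p
    + p * star A * hp + hp * star A * (1 - p)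

lemma projTangent_of_tangent {p a : H →L[ℂ] H} (hp : p * p = p) (hs : star p = p)
    (ha : a * p + p * a = a) (has : star a = a) : projTangent p a = a := by
  simp only [projTangent, star_mul, star_sub, star_one, hs, has]
  linear_combination (norm := noncomm_ring) ha - (2 : ℤ) • mul_eq_zero_of_tangent hp ha

lemma pushforward_compactificationMap_eq {n : ℕ} {r A : H →L[ℂ] H}
    (hr : r ∈ cotangentGrassmannian H n)
    (hA : A * r + r * A = A) :
    pushforward compactificationMap (cotangentGrassmannian H n) r A =
      (projTangent (bundleProj r) A, projTangent (bundleProj (star r)) (star A)) := by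
  have hA' : star A * star r + star r * star A = star A := by
    rw [← star_mul, ← star_mul, ← star_add, add_comm, hA]
  have h1 := (mem_tangentVectors_cotangentGrassmannian hr).2 hA
  have h2 := (mem_tangentVectors_cotangentGrassmannian (star_mem_cotangentGrassmannian hr)).2 hA'
  rw [pushforward_compactificationMap h1, pushforward_bundleProj h1, pushforward_bundleProj h2]
  rfl

lemma extendsField_structI (n : ℕ) :
    ExtendsField compactificationMap (cotangentGrassmannian H n) structI extI := by
  intro r hr A hA
  rw [mem_tangentVectors_cotangentGrassmannian hr] at hA
  rw [pushforward_compactificationMap_eq hr (structI_tangent hA),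
    pushforward_compactificationMap_eq hr hA]
  have hp := bundleProj_mem hr
  have hq := bundleProj_mem (star_mem_cotangentGrassmannian hr)
  refine Prod.ext (projTangent_I_smul hp.1.1 hp.2 A) ?_
  simp only [structI, star_smul, extI, compactificationMap]
  rw [Complex.star_def, Complex.conj_I, neg_smul, projTangent_neg,
    projTangent_I_smul hq.1.1 hq.2]

/-- In the corner (1 - p)·p the commutator [A, r] and A agree, since rp = p and (1 - p)r = 0. So J
and I have the same first component under dΦ; they differ in the second one, as (J_r A)* = J_{r*} A*
while (iA)* = -iA*. -/
lemma projTangent_structJ {r p : H →L[ℂ] H} (h : SameRange p r) (hs : star p = p)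
    (A : H →L[ℂ] H) : projTangent p (structJ r A) = opJ p (projTangent p A) := by
  rw [structJ, opJ_eq, projTangent_I_smul h.idem hs]
  congr 1
  apply projTangent_congr
  linear_combination (norm := noncomm_ring) (1 - p) * A * h.right + h.left * A * p

lemma extendsField_structJ (n : ℕ) :
    ExtendsField compactificationMap (cotangentGrassmannian H n) structJ extJ := by
  intro r hr A hA
  rw [mem_tangentVectors_cotangentGrassmannian hr] at hA
  rw [pushforward_compactificationMap_eq hr (structJ_tangent hr.1 A),
    pushforward_compactificationMap_eq hr hA]
  have e : star (structJ r A) = structJ (star r) (star A) := by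
    simp only [structJ, opJ_eq, star_smul, star_sub, star_mul, Complex.star_def, Complex.conj_I,
      neg_smul, ← smul_neg, neg_sub]
  refine Prod.ext (projTangent_structJ (sameRange_bundleProj hr.1) (star_bundleProj _) A) ?_
  rw [e]
  exact projTangent_structJ (sameRange_bundleProj (star_idem hr.1)) (star_bundleProj _) _

/-- This says that the horizontal lift is a lift. The factor 1 - p removes r[p, a] and the term pa,
which leaves the corner (1 - p)ap of a. -/
lemma projTangent_horizontalLift {p r a : H →L[ℂ] H} (h : SameRange p r)
    (hs : star p = p) (ha : a * p + p * a = a) (has : star a = a) :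
    projTangent p ⁅r, ⁅p, a⁆⁆ = a := by
  conv_rhs => rw [← projTangent_of_tangent h.idem hs ha has]
  apply projTangent_congr
  simp only [Ring.lie_def]
  have h1 : (1 - p) * r = 0 := by
    linear_combination (norm := noncomm_ring) -h.left
  have h2 : (1 - p) * p = 0 := by
    linear_combination (norm := noncomm_ring) -h.idem
  linear_combination (norm := noncomm_ring) h1 * (p * a - a * p) * p - h2 * a * r * p
    + (1 - p) * a * p * h.right + (1 - p) * a * h.idem

/-- Second component of dΦ on horizontal vectors. As qr = q and r(1 - q) = 0, the corner q·(1 - q)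
of the lift is that of [p, a], which is skew-Hermitian; its two off-diagonal corners add up, with
opposite signs, to [q, [p, a]]. -/
lemma projTangent_star_horizontalLift {p q r a : H →L[ℂ] H} (h : Oblique p q r)
    (hs : star p = p) (hqs : star q = q) (has : star a = a) :
    projTangent q (star ⁅r, ⁅p, a⁆⁆) = ⁅q, ⁅p, a⁆⁆ := by
  simp only [Ring.lie_def, projTangent]
  have e : q * (r * (p * a - a * p) - (p * a - a * p) * r) * (1 - q) =
      q * (p * a - a * p) * (1 - q) := by
    linear_combination (norm := noncomm_ring) h.ker_left * (p * a - a * p) * (1 - q)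
      + q * (p * a - a * p) * h.ker_right
  have e' : (1 - q) * star (r * (p * a - a * p) - (p * a - a * p) * r) * q =
      -((1 - q) * (p * a - a * p) * q) := by
    have := congrArg star e
    simp only [star_mul, star_sub, star_one, hs, hqs, has] at this ⊢
    linear_combination (norm := noncomm_ring) this
  rw [e']
  simp only [star_neg, star_mul, star_sub, star_one, hs, hqs, has]
  noncomm_ring

lemma extendsField_structJhat (n : ℕ) :
    ExtendsField compactificationMap (cotangentGrassmannian H n) (structJhat n) extJhat := by
  intro r hr A hA
  have hA' := (mem_tangentVectors_cotangentGrassmannian hr).1 hA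
  rw [pushforward_compactificationMap_eq hr (structJhat_tangent n hr.1 hA'),
    pushforward_compactificationMap_eq hr hA']
  have e : pushforward bundleProj (cotangentGrassmannian H n) r A = projTangent (bundleProj r) A :=
    pushforward_bundleProj hA
  have hpq := oblique_bundleProj hr.1
  have hp := hpq.sameRange.idem
  have hq := (oblique_star_bundleProj hr.1).sameRange.idem
  have hps := star_bundleProj r
  have hqs := star_bundleProj (star r)
  simp only [structJhat, horizontalLift, e, extJhat, compactificationMap]
  set p := bundleProj r
  set q := bundleProj (star r)
  set a := projTangent p A with ha
  set b := projTangent q (star A) with hb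
  have ta : a * p + p * a = a := projTangent_tangent hp hps A
  have sa : star a = a := star_projTangent p A
  have tJ := opJ_tangent hp a
  have sJ := star_opJ hps sa
  refine Prod.ext ?_ ?_
  · simp only
    rw [projTangent_add, projTangent_horizontalLift hpq.sameRange hps tJ sJ,
      projTangent_I_smul hp hps, projTangent_sub,
      projTangent_horizontalLift hpq.sameRange hps ta sa, ← ha, sub_self]
    simp [opJ_eq p 0]
  · simp only
    -- The horizontal part of A has second component -J_q J_p a, so the vertical part has second
    -- component b + J_q J_p a, on which the structure acts by -J_q. The lift of J_p a contributes
    -- -J_q J_p² a = J_q a. The sum is the stated formula.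
    have e1 : ⁅q, ⁅p, a⁆⁆ = -opJ q (opJ p a) := by
      rw [opJ_opJ, Ring.lie_def, Ring.lie_def]; noncomm_ring
    have e2 : ⁅q, ⁅p, opJ p a⁆⁆ = opJ q a := by
      have : -opJ q (opJ p (opJ p a)) = opJ q a := by
        rw [opJ_opJ_of_tangent hp ta, opJ_neg, neg_neg]
      rw [← this, opJ_opJ, Ring.lie_def, Ring.lie_def]; noncomm_ring
    rw [star_add, projTangent_add, projTangent_star_horizontalLift hpq hps hqs sJ, e2,
      star_smul, Complex.star_def, Complex.conj_I, neg_smul, projTangent_neg,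
      projTangent_I_smul hq hqs, star_sub, projTangent_sub,
      projTangent_star_horizontalLift hpq hps hqs sa, e1, ← hb, opJ_sub, opJ_neg]
    abel

end Fields

/-! ### The extended fields are smooth and square to -1; surjectivity of dΦ -/

section EndFields

variable {H : Type u} [NormedAddCommGroup H] [InnerProductSpace ℂ H]

/-- `opJ` as a field of continuous linear maps. -/
noncomputable def opJL (x : H →L[ℂ] H) : (H →L[ℂ] H) →L[ℝ] (H →L[ℂ] H) :=
  (ContinuousLinearMap.mul ℝ (H →L[ℂ] H) (Complex.I • 1)).comp
    ((ContinuousLinearMap.mul ℝ (H →L[ℂ] H)).flip x - ContinuousLinearMap.mul ℝ (H →L[ℂ] H) x)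

lemma opJL_apply (x A : H →L[ℂ] H) : opJL x A = opJ x A := by
  simp [opJL, opJ_eq, smul_sub]

lemma contDiff_opJL : ContDiff ℝ ∞ (opJL (H := H)) := by
  have h1 : ContDiff ℝ ∞ (fun x => ContinuousLinearMap.mul ℝ (H →L[ℂ] H) x) :=
    ContinuousLinearMap.contDiff _
  have h2 : ContDiff ℝ ∞ (fun x => (ContinuousLinearMap.mul ℝ (H →L[ℂ] H)).flip x) :=
    ContinuousLinearMap.contDiff _
  exact contDiff_const.clm_comp (h2.sub h1)

lemma contDiff_opJL_fst :
    ContDiff ℝ ∞ (fun x : (H →L[ℂ] H) × (H →L[ℂ] H) => opJL x.1) :=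
  contDiff_opJL.comp contDiff_fst

lemma contDiff_opJL_snd :
    ContDiff ℝ ∞ (fun x : (H →L[ℂ] H) × (H →L[ℂ] H) => opJL x.2) :=
  contDiff_opJL.comp contDiff_snd

/-- The field of endomorphisms of a product with given components. -/
lemma contDiff_prod_field {E F : Type*} [NormedAddCommGroup E] [NormedSpace ℝ E]
    [NormedAddCommGroup F] [NormedSpace ℝ F] {K L : F → F →L[ℝ] E}
    (hK : ContDiff ℝ ∞ K) (hL : ContDiff ℝ ∞ L) : ContDiff ℝ ∞ (fun x => (K x).prod (L x)) := by
  have e : (fun x => (K x).prod (L x)) = fun x =>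
      (ContinuousLinearMap.inl ℝ E E).comp (K x) + (ContinuousLinearMap.inr ℝ E E).comp (L x) := by
    ext x v <;> simp
  rw [e]
  exact (contDiff_const.clm_comp hK).add (contDiff_const.clm_comp hL)

open ContinuousLinearMap in
noncomputable def extIL (x : (H →L[ℂ] H) × (H →L[ℂ] H)) :
    (H →L[ℂ] H) × (H →L[ℂ] H) →L[ℝ] (H →L[ℂ] H) × (H →L[ℂ] H) :=
  ((opJL x.1).comp (fst ℝ _ _)).prod (-(opJL x.2).comp (snd ℝ _ _))

open ContinuousLinearMap in
noncomputable def extJL (x : (H →L[ℂ] H) × (H →L[ℂ] H)) :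
    (H →L[ℂ] H) × (H →L[ℂ] H) →L[ℝ] (H →L[ℂ] H) × (H →L[ℂ] H) :=
  ((opJL x.1).comp (fst ℝ _ _)).prod ((opJL x.2).comp (snd ℝ _ _))

open ContinuousLinearMap in
noncomputable def extJhatL (x : (H →L[ℂ] H) × (H →L[ℂ] H)) :
    (H →L[ℂ] H) × (H →L[ℂ] H) →L[ℝ] (H →L[ℂ] H) × (H →L[ℂ] H) :=
  ((opJL x.1).comp (fst ℝ _ _)).prod (-(opJL x.2).comp (snd ℝ _ _) +
    (opJL x.2).comp (fst ℝ _ _) -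
    (opJL x.2).comp ((opJL x.2).comp ((opJL x.1).comp (fst ℝ _ _))))

lemma extIL_apply (x X : (H →L[ℂ] H) × (H →L[ℂ] H)) : extIL x X = extI x X := by
  simp [extIL, extI, opJL_apply]

lemma extJL_apply (x X : (H →L[ℂ] H) × (H →L[ℂ] H)) : extJL x X = extJ x X := by
  simp [extJL, extJ, opJL_apply]

lemma extJhatL_apply (x X : (H →L[ℂ] H) × (H →L[ℂ] H)) : extJhatL x X = extJhat x X := by
  simp [extJhatL, extJhat, opJL_apply]

lemma contDiff_extIL : ContDiff ℝ ∞ (extIL (H := H)) :=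
  contDiff_prod_field (contDiff_opJL_fst.clm_comp contDiff_const)
    (contDiff_opJL_snd.clm_comp contDiff_const).neg

lemma contDiff_extJL : ContDiff ℝ ∞ (extJL (H := H)) :=
  contDiff_prod_field (contDiff_opJL_fst.clm_comp contDiff_const)
    (contDiff_opJL_snd.clm_comp contDiff_const)

lemma contDiff_extJhatL : ContDiff ℝ ∞ (extJhatL (H := H)) :=
  contDiff_prod_field (contDiff_opJL_fst.clm_comp contDiff_const)
    (((contDiff_opJL_snd.clm_comp contDiff_const).neg.add
      (contDiff_opJL_snd.clm_comp contDiff_const)).sub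
      (contDiff_opJL_snd.clm_comp (contDiff_opJL_snd.clm_comp
        (contDiff_opJL_fst.clm_comp contDiff_const))))

lemma extI_extI {p q A B : H →L[ℂ] H} (hp : p * p = p) (hq : q * q = q)
    (hA : A * p + p * A = A) (hB : B * q + q * B = B) :
    extI (p, q) (extI (p, q) (A, B)) = -(A, B) :=
  Prod.ext (opJ_opJ_of_tangent hp hA) (by
    simp only [extI, opJ_neg, neg_neg]; exact opJ_opJ_of_tangent hq hB)

lemma extJ_extJ {p q A B : H →L[ℂ] H} (hp : p * p = p) (hq : q * q = q)
    (hA : A * p + p * A = A) (hB : B * q + q * B = B) :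
    extJ (p, q) (extJ (p, q) (A, B)) = -(A, B) :=
  Prod.ext (opJ_opJ_of_tangent hp hA) (opJ_opJ_of_tangent hq hB)

lemma extJhat_extJhat {p q A B : H →L[ℂ] H} (hp : p * p = p) (hq : q * q = q)
    (hA : A * p + p * A = A) (hB : B * q + q * B = B) :
    extJhat (p, q) (extJhat (p, q) (A, B)) = -(A, B) := by
  refine Prod.ext (opJ_opJ_of_tangent hp hA) ?_
  simp only [extJhat, opJ_opJ_of_tangent hp hA, opJ_neg, opJ_add, opJ_sub, opJ_opJ_opJ hq,
    opJ_opJ_of_tangent hq hB, Prod.neg_mk]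
  abel

variable [CompleteSpace H]

lemma isSmoothEndField_of_contDiff {n : ℕ}
    {K : (H →L[ℂ] H) × (H →L[ℂ] H) → (H →L[ℂ] H) × (H →L[ℂ] H) → (H →L[ℂ] H) × (H →L[ℂ] H)}
    {L : (H →L[ℂ] H) × (H →L[ℂ] H) →
      (H →L[ℂ] H) × (H →L[ℂ] H) →L[ℝ] (H →L[ℂ] H) × (H →L[ℂ] H)}
    (hL : ContDiff ℝ ∞ L) (hKL : ∀ x X, L x X = K x X)
    (hK : ∀ x ∈ grassmannian H n ×ˢ grassmannian H n, ∀ X : (H →L[ℂ] H) × (H →L[ℂ] H),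
      (X.1 * x.1 + x.1 * X.1 = X.1 ∧ star X.1 = X.1) ∧
      (X.2 * x.2 + x.2 * X.2 = X.2 ∧ star X.2 = X.2) →
      ((K x X).1 * x.1 + x.1 * (K x X).1 = (K x X).1 ∧ star (K x X).1 = (K x X).1) ∧
      ((K x X).2 * x.2 + x.2 * (K x X).2 = (K x X).2 ∧ star (K x X).2 = (K x X).2)) :
    IsSmoothEndField (grassmannian H n ×ˢ grassmannian H n) K where
  mapsTo x hx A hA := by
    rw [mem_tangentVectors_grassmannian_prod hx] at hA ⊢
    exact hK x hx A hA
  smooth x _ := ⟨Set.univ, isOpen_univ, Set.mem_univ x, L, hL.contDiffOn,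
    fun y _ A _ => (hKL y A).symm⟩

lemma tangent_neg {R : Type*} [Ring R] {p A : R} (hA : A * p + p * A = A) :
    -A * p + p * -A = -A := by
  linear_combination (norm := noncomm_ring) -hA

lemma isSmoothEndField_extI (n : ℕ) :
    IsSmoothEndField (grassmannian H n ×ˢ grassmannian H n) extI := by
  refine isSmoothEndField_of_contDiff contDiff_extIL extIL_apply ?_
  rintro ⟨p, q⟩ ⟨hp, hq⟩ ⟨A, B⟩ ⟨⟨-, hA⟩, -, hB⟩
  exact ⟨⟨opJ_tangent hp.1.1 A, star_opJ hp.2 hA⟩,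
    tangent_neg (opJ_tangent hq.1.1 B), by
      simp only [extI, star_neg]; rw [star_opJ hq.2 hB]⟩

lemma isSmoothEndField_extJ (n : ℕ) :
    IsSmoothEndField (grassmannian H n ×ˢ grassmannian H n) extJ := by
  refine isSmoothEndField_of_contDiff contDiff_extJL extJL_apply ?_
  rintro ⟨p, q⟩ ⟨hp, hq⟩ ⟨A, B⟩ ⟨⟨-, hA⟩, -, hB⟩
  exact ⟨⟨opJ_tangent hp.1.1 A, star_opJ hp.2 hA⟩,
    opJ_tangent hq.1.1 B, star_opJ hq.2 hB⟩

lemma isSmoothEndField_extJhat (n : ℕ) :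
    IsSmoothEndField (grassmannian H n ×ˢ grassmannian H n) extJhat := by
  refine isSmoothEndField_of_contDiff contDiff_extJhatL extJhatL_apply ?_
  rintro ⟨p, q⟩ ⟨hp, hq⟩ ⟨A, B⟩ ⟨⟨-, hA⟩, -, hB⟩
  have e : (extJhat (p, q) (A, B)).2 =
      opJ q (-B + A - opJ q (opJ p A)) := by
    rw [opJ_sub, opJ_add, opJ_neg]; rfl
  refine ⟨⟨opJ_tangent hp.1.1 A, star_opJ hp.2 hA⟩, ?_, ?_⟩ <;> rw [e]
  · exact opJ_tangent hq.1.1 _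
  · refine star_opJ hq.2 ?_
    rw [star_sub, star_add, star_neg, hA, hB, star_opJ hq.2 (star_opJ hp.2 hA)]

lemma projTangent_of_sameRange {p r a : H →L[ℂ] H} (h : SameRange p r) (hs : star p = p)
    (ha : a * p + p * a = a) (has : star a = a) (b : H →L[ℂ] H) :
    projTangent p ((1 - r) * a * r + r * b * (1 - r)) = a := by
  refine Eq.trans (projTangent_congr ?_) (projTangent_of_tangent h.idem hs ha has)
  linear_combination (norm := noncomm_ring) (1 - p) * a * h.right + h.left * a * r * p
    - h.left * b * (1 - r) * p

/-- Every tangent vector of the product at a point of the image comes from the cotangent bundle. -/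
lemma exists_pushforward_eq {n : ℕ} {r : H →L[ℂ] H} (hr : r ∈ cotangentGrassmannian H n)
    {X : (H →L[ℂ] H) × (H →L[ℂ] H)}
    (hX : X ∈ tangentVectors (grassmannian H n ×ˢ grassmannian H n) (compactificationMap r)) :
    ∃ A ∈ tangentVectors (cotangentGrassmannian H n) r,
      pushforward compactificationMap (cotangentGrassmannian H n) r A = X := by
  rw [mem_tangentVectors_grassmannian_prod (compactificationMap_mem hr)] at hX
  have h := oblique_bundleProj hr.1
  have h' := oblique_star_bundleProj hr.1
  have hp := star_bundleProj r
  have hq := star_bundleProj (star r)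
  obtain ⟨a, b⟩ := X
  simp only [compactificationMap] at hX
  obtain ⟨⟨ha, has⟩, hb, hbs⟩ := hX
  -- The preimage of (a, b) is the velocity of the oblique projection when its range moves by a and
  -- its kernel by b, as in `deriv_obliqueProj`.
  have ht : ((1 - r) * a * r + r * b * (1 - r)) * r + r * ((1 - r) * a * r + r * b * (1 - r)) =
      (1 - r) * a * r + r * b * (1 - r) := by
    linear_combination (norm := noncomm_ring) (1 - r) * a * hr.1 - r * b * hr.1 - hr.1 * a * r
      + hr.1 * b * (1 - r)
  refine ⟨_, (mem_tangentVectors_cotangentGrassmannian hr).2 ht, ?_⟩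
  rw [pushforward_compactificationMap_eq hr ht]
  have e : star ((1 - r) * a * r + r * b * (1 - r)) =
      (1 - star r) * b * star r + star r * a * (1 - star r) := by
    simp only [star_add, star_mul, star_sub, star_one, has, hbs]
    noncomm_ring
  rw [e, projTangent_of_sameRange h.sameRange hp ha has,
    projTangent_of_sameRange h'.sameRange hq hb hbs]

end EndFields

/-! ### Isometric frames: compactness and density -/

section Frames

variable {H : Type u} [NormedAddCommGroup H] [InnerProductSpace ℂ H] [CompleteSpace H]

/-- A Hermitian projection of rank `n` is `V V*` for an isometry `V` of `ℂⁿ`. -/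
lemma exists_frame {n : ℕ} {p : H →L[ℂ] H} (hp : p ∈ grassmannian H n) :
    ∃ V : EuclideanSpace ℂ (Fin n) →L[ℂ] H,
      V.adjoint ∘L V = 1 ∧ V ∘L V.adjoint = p := by
  have hr : Module.rank ℂ (LinearMap.range (p : H →ₗ[ℂ] H)) = n := hp.1.2
  have : FiniteDimensional ℂ (LinearMap.range (p : H →ₗ[ℂ] H)) :=
    Module.rank_lt_aleph0_iff.1 (hr ▸ Cardinal.natCast_lt_aleph0)
  have hn : Module.finrank ℂ (LinearMap.range (p : H →ₗ[ℂ] H)) = n :=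
    Module.finrank_eq_of_rank_eq hr
  let b := (stdOrthonormalBasis ℂ (LinearMap.range (p : H →ₗ[ℂ] H))).reindex (finCongr hn)
  let W : EuclideanSpace ℂ (Fin n) →ₗᵢ[ℂ] H :=
    (LinearMap.range (p : H →ₗ[ℂ] H)).subtypeₗᵢ.comp b.repr.symm.toLinearIsometry
  let V := W.toContinuousLinearMap
  have hV : V.adjoint ∘L V = 1 :=
    (ContinuousLinearMap.norm_map_iff_adjoint_comp_self V).1 fun x => W.norm_map x
  have h1 : p ∘L V = V := by
    ext x
    obtain ⟨y, hy⟩ := (b.repr.symm x).2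
    have hy : p y = V x := hy
    change p (V x) = V x
    rw [← hy, ← mul_apply_eq_comp, hp.1.1]
  have h2 : V ∘L V.adjoint ∘L p = p := by
    ext x
    have hx : p x = V (b.repr ⟨p x, LinearMap.mem_range_self _ x⟩) := by
      simp [V, W]
    change V (V.adjoint (p x)) = p x
    rw [hx]
    exact congrArg V (congrArg (fun T => T (b.repr ⟨p x, LinearMap.mem_range_self _ x⟩)) hV)
  refine ⟨V, hV, ?_⟩
  have h3 : p ∘L V ∘L V.adjoint = V ∘L V.adjoint := by
    rw [← ContinuousLinearMap.comp_assoc, h1]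
  -- The adjoint of VV*p = p is pVV* = p, whereas pVV* = VV* because the range of V lies in that of
  -- p.
  have h4 := congrArg ContinuousLinearMap.adjoint h2
  have h5 : p.adjoint = p := hp.2
  simp only [ContinuousLinearMap.adjoint_comp, ContinuousLinearMap.adjoint_adjoint, h5] at h4
  rw [← h3, ← ContinuousLinearMap.comp_assoc, h4]

lemma frame_mem_grassmannian {n : ℕ} {V : EuclideanSpace ℂ (Fin n) →L[ℂ] H}
    (hV : V.adjoint ∘L V = 1) : V ∘L V.adjoint ∈ grassmannian H n := by
  have hi : ∀ x, V.adjoint (V x) = x := fun x => congrArg (fun T => T x) hV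
  have hidem : (V ∘L V.adjoint) * (V ∘L V.adjoint) = V ∘L V.adjoint := by
    ext x
    change V (V.adjoint (V (V.adjoint x))) = V (V.adjoint x)
    rw [hi]
  have hrange : LinearMap.range ((V ∘L V.adjoint : H →L[ℂ] H) : H →ₗ[ℂ] H) =
      LinearMap.range (V : EuclideanSpace ℂ (Fin n) →ₗ[ℂ] H) := by
    apply le_antisymm
    · rintro _ ⟨x, rfl⟩
      exact ⟨V.adjoint x, rfl⟩
    · rintro _ ⟨x, rfl⟩
      exact ⟨V x, congrArg V (hi x)⟩
  have hinj : Function.Injective (V : EuclideanSpace ℂ (Fin n) →ₗ[ℂ] H) :=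
    Function.LeftInverse.injective hi
  refine ⟨⟨hidem, ?_⟩, ?_⟩
  · rw [LinearMap.rank, hrange, ← Module.finrank_eq_rank, LinearMap.finrank_range_of_inj hinj,
      finrank_euclideanSpace_fin]
  · rw [ContinuousLinearMap.star_eq_adjoint, ContinuousLinearMap.adjoint_comp,
      ContinuousLinearMap.adjoint_adjoint]

/-- The Grassmannian is the continuous image under V ↦ VV* of the set of isometries, which is closed
and bounded in a finite-dimensional space. -/
lemma isCompact_grassmannian [FiniteDimensional ℂ H] (n : ℕ) : IsCompact (grassmannian H n) := by
  have e : grassmannian H n = (fun V : EuclideanSpace ℂ (Fin n) →L[ℂ] H => V ∘L V.adjoint) ''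
      {V | V.adjoint ∘L V = 1} := by
    ext p
    constructor
    · intro hp
      obtain ⟨V, hV, rfl⟩ := exists_frame hp
      exact ⟨V, hV, rfl⟩
    · rintro ⟨V, hV, rfl⟩
      exact frame_mem_grassmannian hV
  have hadj : Continuous (fun V : EuclideanSpace ℂ (Fin n) →L[ℂ] H => V.adjoint) :=
    ContinuousLinearMap.adjoint.continuous
  rw [e]
  refine IsCompact.image ?_ (continuous_id.clm_comp hadj)
  have : ProperSpace (EuclideanSpace ℂ (Fin n) →L[ℂ] H) := FiniteDimensional.proper ℂ _
  refine Metric.isCompact_of_isClosed_isBounded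
    (isClosed_eq (hadj.clm_comp continuous_id) continuous_const) ?_
  refine (Metric.isBounded_closedBall (x := 0) (r := 1)).subset fun V hV => ?_
  rw [mem_closedBall_zero_iff]
  refine ContinuousLinearMap.opNorm_le_bound _ zero_le_one fun x => ?_
  rw [(ContinuousLinearMap.norm_map_iff_adjoint_comp_self V).2 hV x, one_mul]

-- Invertibility fails only if -t is in the spectrum, which is finite. The value 0 may belong to the
-- spectrum, so only a punctured neighbourhood is obtained.
open Filter Topology in
lemma eventually_isUnit_add_smul_one {n : ℕ}
    (M : EuclideanSpace ℂ (Fin n) →L[ℂ] EuclideanSpace ℂ (Fin n)) :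
    ∀ᶠ t : ℂ in 𝓝[≠] 0, IsUnit (M + t • 1) := by
  have hfin : (spectrum ℂ M).Finite := by
    have h := Module.End.finite_spectrum (M : Module.End ℂ (EuclideanSpace ℂ (Fin n)))
    rwa [← AlgEquiv.spectrum_eq (Module.End.toContinuousLinearMap (𝕜 := ℂ) _)] at h
  have hclosed : IsClosed ((fun t : ℂ => -t) ⁻¹' (spectrum ℂ M) \ {0}) :=
    ((hfin.preimage neg_injective.injOn).subset Set.sdiff_subset).isClosed
  have h0 : ((fun t : ℂ => -t) ⁻¹' (spectrum ℂ M) \ {0})ᶜ ∈ 𝓝 (0 : ℂ) :=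
    hclosed.isOpen_compl.mem_nhds (by simp)
  filter_upwards [mem_nhdsWithin_of_mem_nhds h0, self_mem_nhdsWithin] with t ht ht0
  have h1 : -t ∉ spectrum ℂ M := fun h => ht ⟨h, ht0⟩
  rw [spectrum.notMem_iff] at h1
  convert h1.neg using 1
  rw [Algebra.algebraMap_eq_smul_one, neg_smul]
  abel

open Filter Topology in
lemma image_dense (n : ℕ) : grassmannian H n ×ˢ grassmannian H n ⊆
    closure (compactificationMap '' (cotangentGrassmannian H n)) := by
  rintro ⟨p, q⟩ ⟨(hp : p ∈ grassmannian H n), (hq : q ∈ grassmannian H n)⟩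
  obtain ⟨V, hV, hVp⟩ := exists_frame hp
  obtain ⟨W, hW, hWq⟩ := exists_frame hq
  let f : ℂ → EuclideanSpace ℂ (Fin n) →L[ℂ] H := fun t => V + t • W
  let D : ℂ → EuclideanSpace ℂ (Fin n) →L[ℂ] EuclideanSpace ℂ (Fin n) := fun t =>
    V.adjoint ∘L f t
  -- For small t this is the projection onto the range of V + tW along the kernel of V*. It is
  -- continuous at t = 0 with value p, which shows that the orthogonal projections onto the ranges
  -- of V + tW tend to p.
  let ρ : ℂ → H →L[ℂ] H := fun t => f t ∘L (Ring.inverse (D t)) ∘L V.adjoint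
  have hf : Continuous f := by fun_prop
  have hD : Continuous D := continuous_const.clm_comp hf
  have hD0 : D 0 = 1 := by simp only [D, f, zero_smul, add_zero, hV]
  have hunit : ∀ᶠ t in 𝓝 (0 : ℂ), IsUnit (D t) :=
    hD.continuousAt.eventually_mem (Units.isOpen.mem_nhds (by rw [hD0]; exact isUnit_one))
  have hinv : ContinuousAt (fun t => Ring.inverse (D t)) 0 := by
    refine ContinuousAt.comp (g := Ring.inverse) ?_ hD.continuousAt
    rw [hD0]
    exact NormedRing.inverse_continuousAt 1
  have hρ : ContinuousAt ρ 0 :=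
    hf.continuousAt.clm_comp (hinv.clm_comp continuousAt_const)
  have hρ0 : ρ 0 = p := by
    simp only [ρ, hD0, Ring.inverse_one]
    simp only [f, zero_smul, add_zero]
    exact hVp
  have hlim : Tendsto (fun t => (obliqueProj (ρ t) (star (ρ t)), q)) (𝓝[≠] 0) (𝓝 (p, q)) := by
    have h1 : ContinuousAt (fun r : H →L[ℂ] H => obliqueProj r (star r)) (ρ 0) := by
      rw [hρ0]
      exact (contDiffAt_obliqueProj_star_of_isUnit (isUnit_add_star_sub_one hp.1.1)).continuousAt
    have h2 : obliqueProj (ρ 0) (star (ρ 0)) = p := by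
      rw [hρ0, ← bundleProj_eq_obliqueProj hp.1.1]
      exact bundleProj_eq hp.2 ⟨hp.1.1, hp.1.1⟩
    have h3 := (ContinuousAt.comp (g := fun r : H →L[ℂ] H => obliqueProj r (star r)) h1 hρ).tendsto
    simp only [Function.comp_def, h2] at h3
    exact (h3.mono_left nhdsWithin_le_nhds).prodMk_nhds tendsto_const_nhds
  refine mem_closure_of_tendsto hlim ?_
  filter_upwards [mem_nhdsWithin_of_mem_nhds hunit,
    eventually_isUnit_add_smul_one (W.adjoint ∘L V)] with t ht1 ht2
  have hWf : W.adjoint ∘L f t = W.adjoint ∘L V + t • 1 := by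
    simp only [f, ContinuousLinearMap.comp_add, ContinuousLinearMap.comp_smul, hW]
  let C := Ring.inverse (W.adjoint ∘L f t)
  have hC : (W.adjoint ∘L f t) * C = 1 := Ring.mul_inverse_cancel _ (hWf ▸ ht2)
  have hC' : ∀ x, W.adjoint (f t (C x)) = x := fun x => congrArg (fun T => T x) hC
  have hC'' : ∀ x, C (W.adjoint (f t x)) = x := fun x =>
    congrArg (fun T => T x) (Ring.inverse_mul_cancel _ (hWf ▸ ht2))
  have hD' : ∀ x, Ring.inverse (D t) (V.adjoint (f t x)) = x := fun x =>
    congrArg (fun T => T x) (Ring.inverse_mul_cancel _ ht1)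
  have hW' : ∀ x, W.adjoint (W x) = x := fun x => congrArg (fun T => T x) hW
  -- The projection onto the same range as ρ(t), but along the kernel of W*, which is the kernel of
  -- q. Hence Φ(r) = (π(ρ(t)), q).
  let r : H →L[ℂ] H := f t ∘L C ∘L W.adjoint
  have hρr : SameRange (ρ t) r := by
    constructor <;> ext x
    · change f t (Ring.inverse (D t) (V.adjoint (f t (C (W.adjoint x))))) = f t (C (W.adjoint x))
      rw [hD']
    · change f t (C (W.adjoint (f t (Ring.inverse (D t) (V.adjoint x))))) =
        f t (Ring.inverse (D t) (V.adjoint x))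
      rw [hC'']
  have hr : SameRange (bundleProj r) r := sameRange_bundleProj hρr.symm.idem
  have hob : Oblique (bundleProj r) q r := by
    refine ⟨hr.left, hr.right, ?_, ?_⟩ <;> rw [← hWq] <;> ext x
    · change f t (C (W.adjoint (W (W.adjoint x)))) = f t (C (W.adjoint x))
      rw [hW']
    · change W (W.adjoint (f t (C (W.adjoint x)))) = W (W.adjoint x)
      rw [hC']
  refine ⟨r, ⟨hob.idem, hob.rank_eq.symm.trans hq.1.2⟩, ?_⟩
  rw [hob.compactificationMap_eq (star_bundleProj r) hq.2, ← bundleProj_congr hρr,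
    bundleProj_eq_obliqueProj hρr.idem]

end Frames

/-! ### Uniqueness of the extensions and the embedding Φ -/

section Uniqueness

variable {H : Type u} [NormedAddCommGroup H] [InnerProductSpace ℂ H] [CompleteSpace H]

open Filter Topology in
/-- An extension to the product is determined on the dense image of the cotangent bundle. -/
lemma eq_of_extendsField {n : ℕ} {J : (H →L[ℂ] H) → (H →L[ℂ] H) → (H →L[ℂ] H)}
    {K K' : (H →L[ℂ] H) × (H →L[ℂ] H) → (H →L[ℂ] H) × (H →L[ℂ] H) → (H →L[ℂ] H) × (H →L[ℂ] H)}
    (hK : IsSmoothEndField (grassmannian H n ×ˢ grassmannian H n) K)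
    (hK' : IsSmoothEndField (grassmannian H n ×ˢ grassmannian H n) K')
    (he : ExtendsField compactificationMap (cotangentGrassmannian H n) J K)
    (he' : ExtendsField compactificationMap (cotangentGrassmannian H n) J K')
    {y X : (H →L[ℂ] H) × (H →L[ℂ] H)} (hy : y ∈ grassmannian H n ×ˢ grassmannian H n)
    (hX : X ∈ tangentVectors (grassmannian H n ×ˢ grassmannian H n) y) : K' y X = K y X := by
  obtain ⟨U, hU, hyU, L, hL, hKL⟩ := hK.smooth y hy
  obtain ⟨U', hU', hyU', L', hL', hKL'⟩ := hK'.smooth y hy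
  -- A continuous field of tangent vectors through X. It allows the two extensions to be compared at
  -- nearby points of the image of Φ, where X itself need not be tangent.
  let P : (H →L[ℂ] H) × (H →L[ℂ] H) → (H →L[ℂ] H) × (H →L[ℂ] H) := fun z =>
    (projTangent z.1 X.1, projTangent z.2 X.2)
  have hP : Continuous P := by
    unfold P projTangent
    fun_prop
  have hPt : ∀ z ∈ grassmannian H n ×ˢ grassmannian H n,
      P z ∈ tangentVectors (grassmannian H n ×ˢ grassmannian H n) z := fun z hz => by
    rw [mem_tangentVectors_grassmannian_prod hz]
    exact ⟨⟨projTangent_tangent hz.1.1.1 hz.1.2 _, star_projTangent _ _⟩,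
      projTangent_tangent hz.2.1.1 hz.2.2 _, star_projTangent _ _⟩
  have hPy : P y = X := by
    rw [mem_tangentVectors_grassmannian_prod hy] at hX
    exact Prod.ext (projTangent_of_tangent hy.1.1.1 hy.1.2 hX.1.1 hX.1.2)
      (projTangent_of_tangent hy.2.1.1 hy.2.2 hX.2.1 hX.2.2)
  have hc : ContinuousAt (fun z => L' z (P z) - L z (P z)) y :=
    ((hL'.continuousOn.continuousAt (hU'.mem_nhds hyU')).clm_apply hP.continuousAt).sub
      ((hL.continuousOn.continuousAt (hU.mem_nhds hyU)).clm_apply hP.continuousAt)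
  have h0 : L' y (P y) - L y (P y) = 0 := by
    by_contra hne
    have hev := hc.eventually_ne hne
    obtain ⟨z, ⟨⟨hne, hzU⟩, hzU'⟩, hz⟩ := mem_closure_iff_nhds.1 (image_dense n hy) _
      (inter_mem (inter_mem hev (hU.mem_nhds hyU)) (hU'.mem_nhds hyU'))
    obtain ⟨r, hr, rfl⟩ := hz
    have hzN := compactificationMap_mem hr
    obtain ⟨A, hA, hAP⟩ := exists_pushforward_eq hr (hPt _ hzN)
    apply hne
    rw [← hKL _ ⟨hzN, hzU⟩ _ (hPt _ hzN), ← hKL' _ ⟨hzN, hzU'⟩ _ (hPt _ hzN), ← hAP,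
      ← he r hr A hA, ← he' r hr A hA, sub_self]
  rw [hPy] at h0
  rw [hKL y ⟨hy, hyU⟩ X hX, hKL' y ⟨hy, hyU'⟩ X hX]
  exact sub_eq_zero.1 h0

lemma isOpenDenseEmbedding_compactificationMap (n : ℕ) :
    IsOpenDenseEmbedding compactificationMap (cotangentGrassmannian H n)
      (grassmannian H n ×ˢ grassmannian H n) where
  mapsTo _ hr := compactificationMap_mem hr
  smooth := smoothMapOn_compactificationMap n
  smooth_inverse := ⟨_, smoothMapOn_obliqueProj n, fun _ hr =>
    obliqueProj_compactificationMap hr.1⟩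
  image_open := ⟨_, isOpen_isUnit_add_sub_one, image_compactificationMap n⟩
  image_dense := image_dense n

lemma smoothMapOn_of_contDiff {E : Type u} [NormedAddCommGroup E] [NormedSpace ℝ E]
    {F : Type v} [NormedAddCommGroup F] [NormedSpace ℝ F] {f : E → F} (hf : ContDiff ℝ ∞ f)
    (M : Set E) : SmoothMapOn f M :=
  smoothMapOn_of_contDiffAt isOpen_univ (Set.subset_univ M) (fun _ _ => hf.contDiffAt)
    (fun _ _ => rfl)

end Uniqueness

/-! ### Complex charts and graph coordinates -/

section Charts

/-- A chart with values in the range of a continuous complex linear projection `T`. -/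
lemma exists_complex_chart {E : Type u} [NormedAddCommGroup E] [NormedSpace ℝ E]
    [NormedSpace ℂ E] [IsScalarTower ℝ ℂ E] [CompleteSpace E] {M : Set E} {K : E → E → E} {x : E}
    (T : E →L[ℂ] E) (hT : ∀ w, T (T w) = T w) {U V : Set E} (hU : IsOpen U) (hx : x ∈ U)
    (hV : IsOpen V) {f g : E → E} (hf : ContDiffOn ℝ ∞ f U) (hg : ContDiffOn ℝ ∞ g V)
    (hfV : ∀ y ∈ M ∩ U, f y ∈ V) (hfT : ∀ y ∈ M ∩ U, T (f y) = f y)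
    (hgM : ∀ w ∈ V, T w = w → g w ∈ M ∩ U)
    (hgf : ∀ y ∈ M ∩ U, g (f y) = y) (hfg : ∀ w ∈ V, T w = w → f (g w) = w)
    (hK : ∀ y ∈ M ∩ U, ∀ A ∈ tangentVectors M y,
      fderiv ℝ f y (K y A) = Complex.I • fderiv ℝ f y A) :
    ∃ (W : Type u) (_ : NormedAddCommGroup W) (_ : NormedSpace ℂ W)
    (_ : CompleteSpace W) (U : Set E) (V : Set W) (φ : E → W) (ψ : W → E),
    IsOpen U ∧ x ∈ U ∧ IsOpen V ∧
    ContDiffOn ℝ ∞ φ U ∧ ContDiffOn ℝ ∞ ψ V ∧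
    Set.MapsTo φ (M ∩ U) V ∧ Set.MapsTo ψ V (M ∩ U) ∧
    Set.LeftInvOn ψ φ (M ∩ U) ∧ Set.RightInvOn ψ φ V ∧
    ∀ y ∈ M ∩ U, ∀ A ∈ tangentVectors M y,
      fderiv ℝ φ y (K y A) = Complex.I • fderiv ℝ φ y A := by
  obtain ⟨W, _, _, _, P, ι, hPι, hιP⟩ : ∃ (W : Type u) (_ : NormedAddCommGroup W)
      (_ : NormedSpace ℂ W) (_ : CompleteSpace W) (P : E →L[ℂ] W) (ι : W →L[ℂ] E),
      (∀ w, P (ι w) = w) ∧ ∀ x, ι (P x) = T x := by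
    -- The model space is the fixed space of T, closed as a kernel and hence complete. Only the
    -- projection onto it and its inclusion are needed afterwards.
    let S := LinearMap.ker ((ContinuousLinearMap.id ℂ E - T : E →L[ℂ] E) : E →ₗ[ℂ] E)
    have hS : ∀ w, w ∈ S ↔ T w = w := fun w => sub_eq_zero.trans eq_comm
    exact ⟨S, inferInstance, inferInstance, inferInstance,
      T.codRestrict S fun w => (hS _).2 (hT w), S.subtypeL,
      fun w => Subtype.ext ((hS _).1 w.2), fun _ => rfl⟩
  have hTι : ∀ w, T (ι w) = ι w := fun w => by rw [← hιP, hPι]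
  let PR : E →L[ℝ] W := P.restrictScalars ℝ
  let ιR : W →L[ℝ] E := ι.restrictScalars ℝ
  refine ⟨W, inferInstance, inferInstance, inferInstance, U, ιR ⁻¹' V, fun y => PR (f y),
    fun w => g (ιR w), hU, hx, hV.preimage ιR.continuous, PR.contDiff.comp_contDiffOn hf,
    hg.comp ιR.contDiff.contDiffOn (Set.mapsTo_preimage _ _), ?_, ?_, ?_, ?_, ?_⟩
  · intro y hy
    change ι (P (f y)) ∈ V
    rw [hιP, hfT y hy]
    exact hfV y hy
  · exact fun w hw => hgM (ι w) hw (hTι w)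
  · intro y hy
    change g (ι (P (f y))) = y
    rw [hιP, hfT y hy, hgf y hy]
  · intro w hw
    change P (f (g (ι w))) = w
    rw [hfg (ι w) hw (hTι w), hPι]
  · intro y hy A hA
    have hd : DifferentiableAt ℝ f y :=
      (hf.differentiableOn (by simp) y hy.2).differentiableAt (hU.mem_nhds hy.2)
    have e : fderiv ℝ (fun y => PR (f y)) y = PR.comp (fderiv ℝ f y) :=
      (PR.hasFDerivAt.comp y hd.hasFDerivAt).fderiv
    rw [e, ContinuousLinearMap.comp_apply, ContinuousLinearMap.comp_apply, hK y hy A hA]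
    exact P.map_smul _ _

/-- The equations between idempotents hold on `M` only. They are differentiated along curves in `M`,
which determines the ambient derivative of a chart on tangent vectors, and nothing more is needed.
-/
lemma fderiv_eq_of_curve {E F : Type*} [NormedAddCommGroup E] [NormedSpace ℝ E]
    [NormedAddCommGroup F] [NormedSpace ℝ F] {M U : Set E} {f : E → F} (hU : IsOpen U)
    (hf : ContDiffOn ℝ ∞ f U) (D : E → E → F)
    (hD : ∀ γ : ℝ → E, ContDiff ℝ ∞ γ → (∀ t, γ t ∈ M) → γ 0 ∈ U →
      ∀ B, HasDerivAt (fun t => f (γ t)) B 0 → B = D (γ 0) (deriv γ 0)) :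
    ∀ y ∈ M ∩ U, ∀ A ∈ tangentVectors M y, fderiv ℝ f y A = D y A := by
  rintro _ ⟨-, hy⟩ _ ⟨γ, hγ, hM, rfl, rfl⟩
  have hd : DifferentiableAt ℝ f (γ 0) :=
    (hf.differentiableOn (by simp) _ hy).differentiableAt (hU.mem_nhds hy)
  exact hD γ hγ hM hy _
    (hd.hasFDerivAt.comp_hasDerivAt 0 (hγ.differentiable (by simp) 0).hasDerivAt)

variable {H : Type u} [NormedAddCommGroup H] [InnerProductSpace ℂ H]

noncomputable def leftCorner (p : H →L[ℂ] H) : (H →L[ℂ] H) →L[ℂ] (H →L[ℂ] H) :=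
  (ContinuousLinearMap.mul ℂ (H →L[ℂ] H) (1 - p)).comp
    ((ContinuousLinearMap.mul ℂ (H →L[ℂ] H)).flip p)

lemma leftCorner_apply (p X : H →L[ℂ] H) : leftCorner p X = (1 - p) * X * p := by
  exact (mul_assoc _ _ _).symm

noncomputable def rightCorner (p : H →L[ℂ] H) : (H →L[ℂ] H) →L[ℂ] (H →L[ℂ] H) :=
  (ContinuousLinearMap.mul ℂ (H →L[ℂ] H) p).comp
    ((ContinuousLinearMap.mul ℂ (H →L[ℂ] H)).flip (1 - p))

lemma rightCorner_apply (p X : H →L[ℂ] H) : rightCorner p X = p * X * (1 - p) := by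
  exact (mul_assoc _ _ _).symm

lemma leftCorner_leftCorner {p : H →L[ℂ] H} (hp : p * p = p) (X : H →L[ℂ] H) :
    leftCorner p (leftCorner p X) = leftCorner p X := by
  simp only [leftCorner_apply]
  linear_combination (norm := noncomm_ring) (1 - p) * (1 - p) * X * hp + hp * X * p

lemma rightCorner_rightCorner {p : H →L[ℂ] H} (hp : p * p = p) (X : H →L[ℂ] H) :
    rightCorner p (rightCorner p X) = rightCorner p X := by
  simp only [rightCorner_apply]
  linear_combination (norm := noncomm_ring) hp * X * (1 - p) * (1 - p) + p * X * hp

lemma leftCorner_sub_of_oblique {p q r : H →L[ℂ] H} (h : Oblique p q r) (hq : q * q = q) :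
    leftCorner q (r - q) = r - q := by
  rw [leftCorner_apply]
  linear_combination (norm := noncomm_ring) (1 - q) * h.ker_right - h.ker_left + q * hq

lemma rightCorner_sub_of_oblique {p q r : H →L[ℂ] H} (h : Oblique p q r) (hp : p * p = p) :
    rightCorner p (r - p) = r - p := by
  rw [rightCorner_apply]
  linear_combination (norm := noncomm_ring) h.range_left * (1 - p) - h.range_right + hp * p

lemma leftCorner_mul_self {p : H →L[ℂ] H} (hp : p * p = p) (X : H →L[ℂ] H) :
    leftCorner p X * p = leftCorner p X ∧ p * leftCorner p X = 0 := by
  simp only [leftCorner_apply]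
  constructor
  · linear_combination (norm := noncomm_ring) (1 - p) * X * hp
  · linear_combination (norm := noncomm_ring) -(hp * X * p)

lemma rightCorner_mul_self {p : H →L[ℂ] H} (hp : p * p = p) (X : H →L[ℂ] H) :
    rightCorner p X * p = 0 ∧ p * rightCorner p X = rightCorner p X := by
  simp only [rightCorner_apply]
  constructor
  · linear_combination (norm := noncomm_ring) -(p * X * hp)
  · linear_combination (norm := noncomm_ring) hp * X * (1 - p)

/-- `p + (1 - p) X p` is an idempotent with the kernel of `p`. -/
lemma add_leftCorner_ker {p : H →L[ℂ] H} (hp : p * p = p) (X : H →L[ℂ] H) :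
    (p + leftCorner p X) * p = p + leftCorner p X ∧ p * (p + leftCorner p X) = p := by
  obtain ⟨h1, h2⟩ := leftCorner_mul_self hp X
  rw [add_mul, mul_add, h1, h2, hp, add_zero]
  exact ⟨rfl, rfl⟩

/-- `p + p X (1 - p)` is an idempotent with the range of `p`. -/
lemma sameRange_add_rightCorner {p : H →L[ℂ] H} (hp : p * p = p) (X : H →L[ℂ] H) :
    SameRange p (p + rightCorner p X) := by
  obtain ⟨h1, h2⟩ := rightCorner_mul_self hp X
  constructor
  · rw [mul_add, h2, hp]
  · rw [add_mul, h1, hp, add_zero]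

lemma contDiff_leftCorner (p : H →L[ℂ] H) : ContDiff ℝ ∞ (leftCorner p) :=
  ((leftCorner p).restrictScalars ℝ).contDiff

lemma contDiff_rightCorner (p : H →L[ℂ] H) : ContDiff ℝ ∞ (rightCorner p) :=
  ((rightCorner p).restrictScalars ℝ).contDiff

variable [CompleteSpace H]

lemma idem_of_ker {R : Type*} [Ring R] {s p : R} (h : s * p = s ∧ p * s = p) : s * s = s := by
  obtain ⟨h1, h2⟩ := h
  linear_combination (norm := noncomm_ring) s * h2 - h1 * s + h1

lemma oblique_bundleProj_of_ker {s p : H →L[ℂ] H} (h : s * p = s ∧ p * s = p) :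
    Oblique (bundleProj s) p s :=
  have h' := sameRange_bundleProj (idem_of_ker h)
  ⟨h'.left, h'.right, h.1, h.2⟩

lemma oblique_bundleProj_star_of_sameRange {s p : H →L[ℂ] H} (h : SameRange p s) :
    Oblique p (bundleProj (star s)) s :=
  have h' := oblique_bundleProj h.symm.idem
  ⟨h.left, h.right, h'.ker_right, h'.ker_left⟩

lemma Oblique.obliqueProj_eq_of_star_eq {p q r : H →L[ℂ] H} (h : Oblique p q r)
    (hp : star p = p) (hq : star q = q) : obliqueProj p q = r :=
  h.obliqueProj_eq (h.star_of_star_eq hp hq)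

lemma Oblique.isUnit_of_star_eq {p q r : H →L[ℂ] H} (h : Oblique p q r)
    (hp : star p = p) (hq : star q = q) : IsUnit (p + q - 1) :=
  h.isUnit (h.star_of_star_eq hp hq)

lemma Oblique.left_mem {n : ℕ} {p q r : H →L[ℂ] H} (h : Oblique p q r)
    (hp : star p = p) (hq : q ∈ grassmannian H n) : p ∈ grassmannian H n :=
  ⟨⟨h.sameRange.idem, by rw [h.sameRange.rank_eq, ← h.rank_eq, hq.1.2]⟩, hp⟩

lemma Oblique.right_mem {n : ℕ} {p q r : H →L[ℂ] H} (h : Oblique p q r)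
    (hq : star q = q) (hp : p ∈ grassmannian H n) : q ∈ grassmannian H n := by
  have h' := h.star_of_star_eq hp.2 hq
  exact h'.left_mem hq hp

/-- The velocity of the oblique projection along two curves of idempotents. -/
lemma deriv_obliqueProj {γ δ : ℝ → H →L[ℂ] H} {A B S : H →L[ℂ] H} (hγ : HasDerivAt γ A 0)
    (hδ : HasDerivAt δ B 0) (hγ' : ∀ t, γ t * γ t = γ t) (hδ' : ∀ t, δ t * δ t = δ t)
    (hu : IsUnit (γ 0 + δ 0 - 1)) (hS : HasDerivAt (fun t => obliqueProj (γ t) (δ t)) S 0) :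
    S = (1 - obliqueProj (γ 0) (δ 0)) * A * obliqueProj (γ 0) (δ 0) +
      obliqueProj (γ 0) (δ 0) * B * (1 - obliqueProj (γ 0) (δ 0)) := by
  have hc : ContinuousAt (fun t => γ t + δ t - 1) 0 :=
    (hγ.continuousAt.add hδ.continuousAt).sub continuousAt_const
  have hev : ∀ᶠ t in nhds (0 : ℝ), Oblique (γ t) (δ t) (obliqueProj (γ t) (δ t)) := by
    filter_upwards [hc.eventually_mem (Units.isOpen.mem_nhds hu)] with t ht
    exact oblique_obliqueProj (hγ' t) (hδ' t) ht
  have e1 := (hγ.mul hS).unique (hS.congr_of_eventuallyEq (hev.mono fun t h => h.range_left))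
  have e2 := (hS.mul hδ).unique (hS.congr_of_eventuallyEq (hev.mono fun t h => h.ker_right))
  have e3 := (hS.mul hS).unique (hS.congr_of_eventuallyEq (hev.mono fun t h => h.idem))
  have h := hev.self_of_nhds
  set r := obliqueProj (γ 0) (δ 0)
  have h0 := mul_eq_zero_of_tangent h.idem e3
  -- Differentiating pr = r and multiplying by 1 - r, which kills p, gives this; rq = r similarly
  -- gives the other corner since q(1 - r) = 0. Finally rSr = 0, so S is the sum of the two corners.
  have k1 : (1 - r) * S = (1 - r) * A * r := by
    linear_combination (norm := noncomm_ring) -((1 - r) * e1) - h.range_right * S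
  have k2 : S * (1 - r) = r * B * (1 - r) := by
    linear_combination (norm := noncomm_ring) - e2 * (1 - r) - S * h.ker_left
  linear_combination (norm := noncomm_ring) k1 + r * k2 + h0 + h.idem * B * (1 - r)

lemma contDiffAt_obliqueProj_comp {E : Type*} [NormedAddCommGroup E] [NormedSpace ℝ E]
    {f g : E → H →L[ℂ] H} {x : E} (hf : ContDiffAt ℝ ∞ f x) (hg : ContDiffAt ℝ ∞ g x)
    (hu : IsUnit (f x + g x - 1)) : ContDiffAt ℝ ∞ (fun y => obliqueProj (f y) (g y)) x :=
  ContDiffAt.comp x (g := fun x : (H →L[ℂ] H) × (H →L[ℂ] H) => obliqueProj x.1 x.2)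
    (f := fun y => (f y, g y)) (contDiffAt_obliqueProj hu) (hf.prodMk hg)

lemma contDiff_bundleProj_comp {E : Type*} [NormedAddCommGroup E] [NormedSpace ℝ E]
    {f : E → H →L[ℂ] H} (hf : ContDiff ℝ ∞ f) (hi : ∀ x, f x * f x = f x) :
    ContDiff ℝ ∞ (fun y => bundleProj (f y)) := by
  simp only [fun x => bundleProj_eq_obliqueProj (hi x)]
  exact contDiff_iff_contDiffAt.2 fun x => contDiffAt_obliqueProj_comp hf.contDiffAt
    (contDiff_star.comp hf).contDiffAt (isUnit_add_star_sub_one (hi x))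

end Charts

/-! ### Holomorphic charts for I and J -/

section ProductCharts

variable {H : Type u} [NormedAddCommGroup H] [InnerProductSpace ℂ H] [CompleteSpace H]
  {n : ℕ} {p₀ : H →L[ℂ] H}

lemma bundleProj_leftCorner_obliqueProj (hp₀ : p₀ ∈ grassmannian H n) {p : H →L[ℂ] H}
    (hp : p ∈ grassmannian H n) (hu : IsUnit (p + p₀ - 1)) :
    bundleProj (p₀ + leftCorner p₀ (obliqueProj p p₀ - p₀)) = p := by
  have h := oblique_of_mem hp hp₀ hu
  rw [leftCorner_sub_of_oblique h hp₀.1.1, add_sub_cancel]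
  exact bundleProj_eq hp.2 h.sameRange

lemma oblique_add_leftCorner (hp₀ : p₀ ∈ grassmannian H n) (X : H →L[ℂ] H) :
    Oblique (bundleProj (p₀ + leftCorner p₀ X)) p₀ (p₀ + leftCorner p₀ X) :=
  oblique_bundleProj_of_ker (add_leftCorner_ker hp₀.1.1 X)

lemma contDiff_bundleProj_leftCorner (hp₀ : p₀ ∈ grassmannian H n) :
    ContDiff ℝ ∞ (fun X => bundleProj (p₀ + leftCorner p₀ X)) :=
  contDiff_bundleProj_comp (contDiff_const.add (contDiff_leftCorner p₀))
    fun X => (oblique_add_leftCorner hp₀ X).idem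

lemma bundleProj_rightCorner_obliqueProj (hp₀ : p₀ ∈ grassmannian H n) {p : H →L[ℂ] H}
    (hp : p ∈ grassmannian H n) (hu : IsUnit (p₀ + p - 1)) :
    bundleProj (star (p₀ + rightCorner p₀ (obliqueProj p₀ p - p₀))) = p := by
  have h := oblique_of_mem hp₀ hp hu
  rw [rightCorner_sub_of_oblique h hp₀.1.1, add_sub_cancel]
  exact bundleProj_eq hp.2 (h.star_of_star_eq hp₀.2 hp.2).sameRange

lemma oblique_add_rightCorner (hp₀ : p₀ ∈ grassmannian H n) (X : H →L[ℂ] H) :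
    Oblique p₀ (bundleProj (star (p₀ + rightCorner p₀ X))) (p₀ + rightCorner p₀ X) :=
  oblique_bundleProj_star_of_sameRange (sameRange_add_rightCorner hp₀.1.1 X)

lemma contDiff_bundleProj_rightCorner (hp₀ : p₀ ∈ grassmannian H n) :
    ContDiff ℝ ∞ (fun X => bundleProj (star (p₀ + rightCorner p₀ X))) :=
  contDiff_bundleProj_comp (contDiff_star.comp (contDiff_const.add (contDiff_rightCorner p₀)))
    fun X => star_idem (oblique_add_rightCorner hp₀ X).idem

lemma isUnit_self_add_self_sub_one {R : Type*} [Ring R] {p : R} (hp : p * p = p) :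
    IsUnit (p + p - 1) :=
  have h : Oblique p p p := ⟨hp, hp, hp, hp⟩
  h.isUnit h

lemma isOpen_isUnit_add_const (p₀ : H →L[ℂ] H) : IsOpen {p : H →L[ℂ] H | IsUnit (p + p₀ - 1)} :=
  Units.isOpen.preimage (by fun_prop : Continuous fun p : H →L[ℂ] H => p + p₀ - 1)

lemma isOpen_isUnit_const_add (p₀ : H →L[ℂ] H) : IsOpen {p : H →L[ℂ] H | IsUnit (p₀ + p - 1)} :=
  Units.isOpen.preimage (by fun_prop : Continuous fun p : H →L[ℂ] H => p₀ + p - 1)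

lemma contDiffOn_obliqueProj_left (p₀ : H →L[ℂ] H) :
    ContDiffOn ℝ ∞ (fun p => obliqueProj p p₀) {p : H →L[ℂ] H | IsUnit (p + p₀ - 1)} :=
  fun _ hp => (contDiffAt_obliqueProj_comp contDiffAt_id contDiffAt_const hp).contDiffWithinAt

lemma contDiffOn_obliqueProj_right (p₀ : H →L[ℂ] H) :
    ContDiffOn ℝ ∞ (fun p => obliqueProj p₀ p) {p : H →L[ℂ] H | IsUnit (p₀ + p - 1)} :=
  fun _ hp => (contDiffAt_obliqueProj_comp contDiffAt_const contDiffAt_id hp).contDiffWithinAt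

/-- By ps = s and (1 - s)p = 0, the commutator [A, p] and A agree in this corner. The corner is the
velocity of s when the range moves, so s is holomorphic in p for J_p. -/
lemma leftCorner_opJ {p s A : H →L[ℂ] H} (h : SameRange p s) :
    (1 - s) * opJ p A * s = Complex.I • ((1 - s) * A * s) := by
  simp only [opJ_eq, mul_smul_comm, smul_mul_assoc]
  congr 1
  linear_combination (norm := noncomm_ring) (1 - s) * A * h.left + h.right * A * s

/-- Here q(1 - s) = 0 and sq = s leave the other term of the commutator, whence the sign: as a
function of its kernel, the projection is holomorphic for -J_q. -/
lemma rightCorner_opJ {p q s B : H →L[ℂ] H} (h : Oblique p q s) :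
    s * (-opJ q B) * (1 - s) = Complex.I • (s * B * (1 - s)) := by
  simp only [opJ_eq, ← smul_neg, mul_smul_comm, smul_mul_assoc]
  congr 1
  linear_combination (norm := noncomm_ring) s * B * h.ker_left + h.ker_right * B * (1 - s)

/-- In both factors the chart is the graph coordinate in which the range varies. It is onto the
whole corner, as every p₀ + (1 - p₀)Xp₀ is a projection along the kernel of p₀. -/
lemma isComplexStructureOn_extJ (n : ℕ) :
    IsComplexStructureOn (grassmannian H n ×ˢ grassmannian H n) extJ where
  endField := isSmoothEndField_extJ n
  sq x hx A hA := by
    rw [mem_tangentVectors_grassmannian_prod hx] at hA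
    exact extJ_extJ hx.1.1.1 hx.2.1.1 hA.1.1 hA.2.1
  integrable := by
    rintro ⟨p₀, q₀⟩ ⟨(hp₀ : p₀ ∈ _), (hq₀ : q₀ ∈ _)⟩
    have hU := (isOpen_isUnit_add_const p₀).prod (isOpen_isUnit_add_const q₀)
    have hf : ContDiffOn ℝ ∞ (fun y : (H →L[ℂ] H) × (H →L[ℂ] H) =>
        (obliqueProj y.1 p₀ - p₀, obliqueProj y.2 q₀ - q₀))
        ({p | IsUnit (p + p₀ - 1)} ×ˢ {p | IsUnit (p + q₀ - 1)}) :=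
      (((contDiffOn_obliqueProj_left p₀).comp contDiffOn_fst fun _ h => h.1).sub
        contDiffOn_const).prodMk
      (((contDiffOn_obliqueProj_left q₀).comp contDiffOn_snd fun _ h => h.2).sub
        contDiffOn_const)
    have hd := fderiv_eq_of_curve (M := grassmannian H n ×ˢ grassmannian H n) hU hf
      (fun y A => ((1 - obliqueProj y.1 p₀) * A.1 * obliqueProj y.1 p₀,
        (1 - obliqueProj y.2 q₀) * A.2 * obliqueProj y.2 q₀)) (by
      intro γ hγ hM hγU B hB
      have h := (hγ.differentiable (by simp) 0).hasDerivAt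
      have h1 := (hasFDerivAt_fst (𝕜 := ℝ) (p := γ 0)).comp_hasDerivAt 0 h
      have h2 := (hasFDerivAt_snd (𝕜 := ℝ) (p := γ 0)).comp_hasDerivAt 0 h
      have hB1 := (hasFDerivAt_fst (𝕜 := ℝ)).comp_hasDerivAt 0 hB
      have hB2 := (hasFDerivAt_snd (𝕜 := ℝ)).comp_hasDerivAt 0 hB
      have k1 := deriv_obliqueProj h1 (hasDerivAt_const 0 p₀) (fun t => (hM t).1.1.1)
        (fun _ => hp₀.1.1) hγU.1 ((hB1.add_const p₀).congr_of_eventuallyEq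
          (.of_forall fun t => (sub_add_cancel _ p₀).symm))
      have k2 := deriv_obliqueProj h2 (hasDerivAt_const 0 q₀) (fun t => (hM t).2.1.1)
        (fun _ => hq₀.1.1) hγU.2 ((hB2.add_const q₀).congr_of_eventuallyEq
          (.of_forall fun t => (sub_add_cancel _ q₀).symm))
      simp only [mul_zero, zero_mul, add_zero] at k1 k2
      exact Prod.ext k1 k2)
    refine exists_complex_chart (V := Set.univ)
      ((leftCorner p₀).prodMap (leftCorner q₀))
      (fun w => Prod.ext (leftCorner_leftCorner hp₀.1.1 _) (leftCorner_leftCorner hq₀.1.1 _))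
      hU ⟨isUnit_self_add_self_sub_one hp₀.1.1, isUnit_self_add_self_sub_one hq₀.1.1⟩
      isOpen_univ hf
      (g := fun w => (bundleProj (p₀ + leftCorner p₀ w.1), bundleProj (q₀ + leftCorner q₀ w.2)))
      (((contDiff_bundleProj_leftCorner hp₀).comp contDiff_fst).prodMk
        ((contDiff_bundleProj_leftCorner hq₀).comp contDiff_snd)).contDiffOn
      (fun _ _ => Set.mem_univ _) ?_ ?_ ?_ ?_ ?_
    · rintro y ⟨hy, hyU⟩
      exact Prod.ext (leftCorner_sub_of_oblique (oblique_of_mem hy.1 hp₀ hyU.1) hp₀.1.1)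
        (leftCorner_sub_of_oblique (oblique_of_mem hy.2 hq₀ hyU.2) hq₀.1.1)
    · intro w _ _
      have h1 := oblique_add_leftCorner hp₀ w.1
      have h2 := oblique_add_leftCorner hq₀ w.2
      exact ⟨⟨h1.left_mem (star_bundleProj _) hp₀, h2.left_mem (star_bundleProj _) hq₀⟩,
        h1.isUnit_of_star_eq (star_bundleProj _) hp₀.2,
        h2.isUnit_of_star_eq (star_bundleProj _) hq₀.2⟩
    · rintro y ⟨hy, hyU⟩
      exact Prod.ext (bundleProj_leftCorner_obliqueProj hp₀ hy.1 hyU.1)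
        (bundleProj_leftCorner_obliqueProj hq₀ hy.2 hyU.2)
    · intro w _ hw
      have h1 := oblique_add_leftCorner hp₀ w.1
      have h2 := oblique_add_leftCorner hq₀ w.2
      refine Eq.trans (Prod.ext ?_ ?_) hw
      · exact sub_eq_of_eq_add' (h1.obliqueProj_eq_of_star_eq (star_bundleProj _) hp₀.2)
      · exact sub_eq_of_eq_add' (h2.obliqueProj_eq_of_star_eq (star_bundleProj _) hq₀.2)
    · intro y hy A hA
      rw [hd y hy A hA, hd y hy _ ((isSmoothEndField_extJ n).mapsTo y hy.1 A hA)]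
      exact Prod.ext (leftCorner_opJ (oblique_of_mem hy.1.1 hp₀ hy.2.1).sameRange)
        (leftCorner_opJ (oblique_of_mem hy.1.2 hq₀ hy.2.2).sameRange)

/-- The sign in the second factor is accounted for by a coordinate in which the range q₀ is fixed
and the kernel is that of q. -/
lemma isComplexStructureOn_extI (n : ℕ) :
    IsComplexStructureOn (grassmannian H n ×ˢ grassmannian H n) extI where
  endField := isSmoothEndField_extI n
  sq x hx A hA := by
    rw [mem_tangentVectors_grassmannian_prod hx] at hA
    exact extI_extI hx.1.1.1 hx.2.1.1 hA.1.1 hA.2.1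
  integrable := by
    rintro ⟨p₀, q₀⟩ ⟨(hp₀ : p₀ ∈ _), (hq₀ : q₀ ∈ _)⟩
    have hU := (isOpen_isUnit_add_const p₀).prod (isOpen_isUnit_const_add q₀)
    have hf : ContDiffOn ℝ ∞ (fun y : (H →L[ℂ] H) × (H →L[ℂ] H) =>
        (obliqueProj y.1 p₀ - p₀, obliqueProj q₀ y.2 - q₀))
        ({p | IsUnit (p + p₀ - 1)} ×ˢ {p | IsUnit (q₀ + p - 1)}) :=
      (((contDiffOn_obliqueProj_left p₀).comp contDiffOn_fst fun _ h => h.1).sub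
        contDiffOn_const).prodMk
      (((contDiffOn_obliqueProj_right q₀).comp contDiffOn_snd fun _ h => h.2).sub
        contDiffOn_const)
    have hd := fderiv_eq_of_curve (M := grassmannian H n ×ˢ grassmannian H n) hU hf
      (fun y A => ((1 - obliqueProj y.1 p₀) * A.1 * obliqueProj y.1 p₀,
        obliqueProj q₀ y.2 * A.2 * (1 - obliqueProj q₀ y.2))) (by
      intro γ hγ hM hγU B hB
      have h := (hγ.differentiable (by simp) 0).hasDerivAt
      have h1 := (hasFDerivAt_fst (𝕜 := ℝ) (p := γ 0)).comp_hasDerivAt 0 h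
      have h2 := (hasFDerivAt_snd (𝕜 := ℝ) (p := γ 0)).comp_hasDerivAt 0 h
      have hB1 := (hasFDerivAt_fst (𝕜 := ℝ)).comp_hasDerivAt 0 hB
      have hB2 := (hasFDerivAt_snd (𝕜 := ℝ)).comp_hasDerivAt 0 hB
      have k1 := deriv_obliqueProj h1 (hasDerivAt_const 0 p₀) (fun t => (hM t).1.1.1)
        (fun _ => hp₀.1.1) hγU.1 ((hB1.add_const p₀).congr_of_eventuallyEq
          (.of_forall fun t => (sub_add_cancel _ p₀).symm))
      have k2 := deriv_obliqueProj (hasDerivAt_const 0 q₀) h2 (fun _ => hq₀.1.1)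
        (fun t => (hM t).2.1.1) hγU.2 ((hB2.add_const q₀).congr_of_eventuallyEq
          (.of_forall fun t => (sub_add_cancel _ q₀).symm))
      simp only [mul_zero, zero_mul, add_zero, zero_add] at k1 k2
      exact Prod.ext k1 k2)
    refine exists_complex_chart (V := Set.univ)
      ((leftCorner p₀).prodMap (rightCorner q₀))
      (fun w => Prod.ext (leftCorner_leftCorner hp₀.1.1 _) (rightCorner_rightCorner hq₀.1.1 _))
      hU ⟨isUnit_self_add_self_sub_one hp₀.1.1, isUnit_self_add_self_sub_one hq₀.1.1⟩
      isOpen_univ hf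
      (g := fun w => (bundleProj (p₀ + leftCorner p₀ w.1),
        bundleProj (star (q₀ + rightCorner q₀ w.2))))
      (((contDiff_bundleProj_leftCorner hp₀).comp contDiff_fst).prodMk
        ((contDiff_bundleProj_rightCorner hq₀).comp contDiff_snd)).contDiffOn
      (fun _ _ => Set.mem_univ _) ?_ ?_ ?_ ?_ ?_
    · rintro y ⟨hy, hyU⟩
      exact Prod.ext (leftCorner_sub_of_oblique (oblique_of_mem hy.1 hp₀ hyU.1) hp₀.1.1)
        (rightCorner_sub_of_oblique (oblique_of_mem hq₀ hy.2 hyU.2) hq₀.1.1)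
    · intro w _ _
      have h1 := oblique_add_leftCorner hp₀ w.1
      have h2 := oblique_add_rightCorner hq₀ w.2
      exact ⟨⟨h1.left_mem (star_bundleProj _) hp₀, h2.right_mem (star_bundleProj _) hq₀⟩,
        h1.isUnit_of_star_eq (star_bundleProj _) hp₀.2,
        h2.isUnit_of_star_eq hq₀.2 (star_bundleProj _)⟩
    · rintro y ⟨hy, hyU⟩
      exact Prod.ext (bundleProj_leftCorner_obliqueProj hp₀ hy.1 hyU.1)
        (bundleProj_rightCorner_obliqueProj hq₀ hy.2 hyU.2)
    · intro w _ hw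
      have h1 := oblique_add_leftCorner hp₀ w.1
      have h2 := oblique_add_rightCorner hq₀ w.2
      refine Eq.trans (Prod.ext ?_ ?_) hw
      · exact sub_eq_of_eq_add' (h1.obliqueProj_eq_of_star_eq (star_bundleProj _) hp₀.2)
      · exact sub_eq_of_eq_add' (h2.obliqueProj_eq_of_star_eq hq₀.2 (star_bundleProj _))
    · intro y hy A hA
      rw [hd y hy A hA, hd y hy _ ((isSmoothEndField_extI n).mapsTo y hy.1 A hA)]
      exact Prod.ext (leftCorner_opJ (oblique_of_mem hy.1.1 hp₀ hy.2.1).sameRange)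
        (rightCorner_opJ (oblique_of_mem hq₀ hy.1.2 hy.2.2))

end ProductCharts

/-! ### The holomorphic frame and the fibre coordinate for Ĵ -/

section BundleChart

section Algebra

variable {R : Type*} [Ring R] {p₀ q₀ p q s g g' r : R}

/-- The frame which maps the range and the kernel of `p₀` to those of `p`, for the projection `s`
onto the range of `p` along the kernel of `p₀`. -/
def frameMap (p₀ p s : R) : R := s + (1 - p) * (1 - p₀)

/-- The inverse of `frameMap`. -/
def frameInv (p₀ p s : R) : R := p₀ * p + 1 - s

/-- On the range of p the proposed inverse is p₀, which inverts s from the range of p₀ to that of p.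
On the kernel of p it is 1 - s, which inverts 1 - p from the kernel of p₀ to that of p. -/
lemma frameInv_mul_frameMap (h : Oblique p p₀ s) :
    frameInv p₀ p s * frameMap p₀ p s = 1 := by
  have h1 := h.range_left
  have h2 := h.range_right
  have h3 := h.ker_right
  have h4 := h.ker_left
  have hp := h.sameRange.idem
  have hs := h.idem
  simp only [frameInv, frameMap]
  linear_combination (norm := noncomm_ring) p₀ * h1 + h4 - p₀ * hp * (1 - p₀) - hs
    + h3 + h2 * (1 - p₀)

lemma frameMap_mul_frameInv (h : Oblique p p₀ s) :
    frameMap p₀ p s * frameInv p₀ p s = 1 := by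
  have h1 := h.range_left
  have h2 := h.range_right
  have h3 := h.ker_right
  have h4 := h.ker_left
  have hs := h.idem
  have hp₀ : p₀ * p₀ = p₀ := by
    linear_combination (norm := noncomm_ring) p₀ * h3 - h4 * p₀ + h4
  simp only [frameInv, frameMap]
  linear_combination (norm := noncomm_ring) h3 * p + h2 - hs + h1 + (1 - p) * h4
    - (1 - p) * hp₀ * p

/-- The map that is invertible where the second component of the chart is defined. -/
def chartUnit (q₀ q g : R) : R := q * g * q₀ + (1 - q) * (1 - q₀)

/-- The projection onto the range of `q₀` along the preimage under `g` of the kernel of `q`. -/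
noncomputable def pullbackProj (q₀ q g : R) : R := Ring.inverse (chartUnit q₀ q g) * q * g

/-- Both diagonal terms respect the splittings, so the map carries range and kernel of q₀ into those
of q. When it is invertible, so does its inverse in the other direction, which places the range of
`pullbackProj` in that of q₀. -/
lemma chartUnit_mul (hq₀ : q₀ * q₀ = q₀) (hq : q * q = q) :
    chartUnit q₀ q g * q₀ = q * chartUnit q₀ q g := by
  simp only [chartUnit]
  linear_combination (norm := noncomm_ring) q * g * hq₀ - (1 - q) * hq₀ - hq * g * q₀
    + hq * (1 - q₀)

lemma inverse_chartUnit_mul (hq₀ : q₀ * q₀ = q₀) (hq : q * q = q)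
    (hu : IsUnit (chartUnit q₀ q g)) :
    Ring.inverse (chartUnit q₀ q g) * q = q₀ * Ring.inverse (chartUnit q₀ q g) := by
  have h := chartUnit_mul (g := g) hq₀ hq
  obtain ⟨w, hw⟩ := hu
  rw [← hw] at h ⊢
  rw [Ring.inverse_unit, ← Units.mul_left_inj w, mul_assoc, ← h, Units.inv_mul_cancel_left,
    Units.inv_mul_cancel_right]

lemma chartUnit_mul_pullbackProj (hu : IsUnit (chartUnit q₀ q g)) :
    chartUnit q₀ q g * pullbackProj q₀ q g = q * g := by
  rw [pullbackProj, ← mul_assoc, ← mul_assoc, Ring.mul_inverse_cancel _ hu, one_mul]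

lemma sameRange_pullbackProj (hq₀ : q₀ * q₀ = q₀) (hq : q * q = q)
    (hu : IsUnit (chartUnit q₀ q g)) : SameRange q₀ (pullbackProj q₀ q g) := by
  constructor
  · rw [pullbackProj, inverse_chartUnit_mul hq₀ hq hu, ← mul_assoc, ← mul_assoc, hq₀]
  · have h : q * g * q₀ = chartUnit q₀ q g * q₀ := by
      simp only [chartUnit]
      linear_combination (norm := noncomm_ring) (1 - q) * hq₀ - q * g * hq₀
    rw [pullbackProj, mul_assoc, mul_assoc, ← mul_assoc q, h, ← mul_assoc,
      Ring.inverse_mul_cancel _ hu, one_mul]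

lemma mul_pullbackProj (hq₀ : q₀ * q₀ = q₀) (hq : q * q = q)
    (hu : IsUnit (chartUnit q₀ q g)) : q * g * pullbackProj q₀ q g = q * g := by
  have h1 := chartUnit_mul_pullbackProj hu
  have h2 := (sameRange_pullbackProj hq₀ hq hu).left
  simp only [chartUnit] at h1
  linear_combination (norm := noncomm_ring) h1 + (1 - q - q * g) * h2

lemma pullbackProj_eq (h : SameRange q₀ r) (hr : q * g * r = q * g)
    (hu : IsUnit (chartUnit q₀ q g)) : pullbackProj q₀ q g = r := by
  have h1 : q * g = chartUnit q₀ q g * r := by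
    simp only [chartUnit]
    linear_combination (norm := noncomm_ring) -hr - (q * g - 1 + q) * h.left
  rw [pullbackProj, mul_assoc, h1, ← mul_assoc, Ring.inverse_mul_cancel _ hu, one_mul]

lemma conj_pullbackProj (hq₀ : q₀ * q₀ = q₀) (hq : q * q = q) (hu : IsUnit (chartUnit q₀ q g))
    (hg : g * g' = 1) :
    q * (g * pullbackProj q₀ q g * g') = q ∧
      (g * pullbackProj q₀ q g * g') * q = g * pullbackProj q₀ q g * g' := by
  have h1 := mul_pullbackProj hq₀ hq hu
  constructor
  · linear_combination (norm := noncomm_ring) h1 * g' + q * hg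
  · simp only [pullbackProj]
    linear_combination (norm := noncomm_ring)
      g * Ring.inverse (chartUnit q₀ q g) * q * hg * (q - 1)
      + g * Ring.inverse (chartUnit q₀ q g) * hq

/-- The algebraic identity behind the holomorphy of the second component of the chart. -/
lemma frame_velocity_identity {A B c : R} (hq : q * q = q)
    (hp : p * p = p) (hA : A * p + p * A = A) (h : Oblique p p₀ s) (hc : c = A * p - p * A)
    (hr : q * frameMap p₀ p s * (1 - r) = 0) :
    q * ((-(B * q - q * B) + (A * q - q * A) + ((c * q - q * c) * q - q * (c * q - q * c))) *
        frameMap p₀ p s + q * ((1 - s) * c * s - c * (1 - p₀))) * (1 - r) =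
      q * (B * frameMap p₀ p s + q * ((1 - s) * A * s - A * (1 - p₀))) * (1 - r) := by
  have hps := h.range_left
  have hsp := h.range_right
  have h0 := mul_eq_zero_of_tangent hp hA
  -- Passing from A to c = [A, p] does not change the velocity of s; the term from 1 - p changes by
  -- 2pA(1 - p₀). This is the failure of the frame to be holomorphic as a map into operators on the
  -- constant space H.
  have e2 : (1 - s) * c * s - c * (1 - p₀) =
      (1 - s) * A * s - A * (1 - p₀) + (2 : ℤ) • (p * A * (1 - p₀)) := by
    rw [hc]
    linear_combination (norm := noncomm_ring) (1 - s) * A * hps + hsp * A * s - hA * (1 - p₀)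
  have e3 : p * A * frameMap p₀ p s = p * A * (1 - p₀) := by
    simp only [frameMap]
    linear_combination (norm := noncomm_ring) -(p * A * hps) + h0 * s - h0 * (1 - p₀)
  rw [e2]
  generalize frameMap p₀ p s = g at *
  -- To the left of Z = g(1 - r), which q kills, the terms reduce to qB + q(c - A) with c - A =
  -- -2pA. By `e3` this error cancels the one in `e2`; the terms J_q A and J_q² J_p A of Ĵ are there
  -- for this.
  have e1 : q * (-(B * q - q * B) + (A * q - q * A) +
      ((c * q - q * c) * q - q * (c * q - q * c))) * (g * (1 - r)) =
      q * B * (g * (1 - r)) - (2 : ℤ) • (q * p * A * (g * (1 - r))) := by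
    have hZ : q * (g * (1 - r)) = 0 := by rw [← mul_assoc, hr]
    have hcA : c - A + (2 : ℤ) • (p * A) = 0 := by
      rw [hc]
      linear_combination (norm := noncomm_ring) hA
    generalize g * (1 - r) = Z at *
    linear_combination (norm := noncomm_ring) -(q * B * hZ) + hq * B * Z + q * A * hZ
      - hq * A * Z + q * c * q * hZ - (2 : ℤ) • (q * q * c * hZ) + q * hq * c * Z + hq * c * Z
      + q * hcA * Z
  linear_combination (norm := noncomm_ring) e1 - (2 : ℤ) • (q * e3 * (1 - r))
    + (2 : ℤ) • (hq * p * A * (1 - p₀) * (1 - r))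

end Algebra

variable {H : Type u} [NormedAddCommGroup H] [InnerProductSpace ℂ H]

/-- With i factored out, complex linearity of the differential of the chart becomes an identity in a
ring without scalars. -/
lemma extJhat_eq (p q A B : H →L[ℂ] H) : extJhat (p, q) (A, B) =
    (Complex.I • (A * p - p * A), Complex.I • (-(B * q - q * B) + (A * q - q * A) +
      (((A * p - p * A) * q - q * (A * p - p * A)) * q -
        q * ((A * p - p * A) * q - q * (A * p - p * A))))) := by
  refine Prod.ext rfl ?_
  simp only [extJhat]
  rw [opJ_opJ q q, opJ_eq, opJ_eq, opJ_eq]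
  generalize A * p - p * A = c
  simp only [smul_add, smul_sub, smul_neg, smul_mul_assoc, mul_smul_comm, mul_sub, sub_mul]
  abel

variable [CompleteSpace H]

/-- The velocity of the second component of the chart. -/
lemma deriv_pullbackProj {γ δ : ℝ → H →L[ℂ] H} {q₀ B G S : H →L[ℂ] H} (hγ : HasDerivAt γ B 0)
    (hδ : HasDerivAt δ G 0) (hγ' : ∀ t, γ t * γ t = γ t) (hq₀ : q₀ * q₀ = q₀)
    (hu : IsUnit (chartUnit q₀ (γ 0) (δ 0)))
    (hS : HasDerivAt (fun t => pullbackProj q₀ (γ t) (δ t)) S 0) :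
    S = Ring.inverse (chartUnit q₀ (γ 0) (δ 0)) *
      (γ 0 * (B * δ 0 + γ 0 * G) * (1 - pullbackProj q₀ (γ 0) (δ 0))) := by
  have hc : ContinuousAt (fun t => chartUnit q₀ (γ t) (δ t)) 0 :=
    ((hγ.continuousAt.mul hδ.continuousAt).mul continuousAt_const).add
      ((continuousAt_const.sub hγ.continuousAt).mul continuousAt_const)
  have hev : ∀ᶠ t in nhds (0 : ℝ), IsUnit (chartUnit q₀ (γ t) (δ t)) :=
    hc.eventually_mem (Units.isOpen.mem_nhds hu)
  have e1 := ((hasDerivAt_const 0 q₀).mul hS).unique (hS.congr_of_eventuallyEq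
    (hev.mono fun t h => (sameRange_pullbackProj hq₀ (hγ' t) h).left))
  have e2 := (hS.mul (hasDerivAt_const 0 q₀)).unique ((hasDerivAt_const 0 q₀).congr_of_eventuallyEq
    (hev.mono fun t h => (sameRange_pullbackProj hq₀ (hγ' t) h).right))
  have e3 := ((hγ.mul hδ).mul hS).unique ((hγ.mul hδ).congr_of_eventuallyEq
    (hev.mono fun t h => mul_pullbackProj hq₀ (hγ' t) h))
  have h := sameRange_pullbackProj hq₀ (hγ' 0) hu
  have hq := hγ' 0
  simp only [zero_mul, mul_zero, zero_add, add_zero] at e1 e2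
  simp only [Pi.mul_apply] at e3
  -- The range of r = `pullbackProj` is fixed, so S = q₀S = rS. Writing r = k⁻¹qg, with k the chart
  -- unit, reduces the claim to qgS, which is found by differentiating qgr = qg.
  have e4 : S = pullbackProj q₀ (γ 0) (δ 0) * S := by
    linear_combination (norm := noncomm_ring) -(h.right * S) - e1
      + pullbackProj q₀ (γ 0) (δ 0) * e1
  have e5 : pullbackProj q₀ (γ 0) (δ 0) * S =
      Ring.inverse (chartUnit q₀ (γ 0) (δ 0)) * (γ 0 * (γ 0 * δ 0 * S)) := by
    simp only [pullbackProj]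
    linear_combination (norm := noncomm_ring)
      -(Ring.inverse (chartUnit q₀ (γ 0) (δ 0)) * hq * δ 0 * S)
  rw [e4, e5]
  congr 1
  linear_combination (norm := noncomm_ring) γ 0 * e3

end BundleChart

/-! ### The charts for Ĵ and the conclusion -/

section BundleCharts

variable {H : Type u} [NormedAddCommGroup H] [InnerProductSpace ℂ H] [CompleteSpace H]
  {n : ℕ} {p₀ q₀ : H →L[ℂ] H}

/-- The frame over the domain of the chart of the Grassmannian at `p₀`. -/
noncomputable def chartFrame (p₀ p : H →L[ℂ] H) : H →L[ℂ] H := frameMap p₀ p (obliqueProj p p₀)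

lemma contDiffOn_chartFrame (p₀ : H →L[ℂ] H) :
    ContDiffOn ℝ ∞ (chartFrame p₀) {p : H →L[ℂ] H | IsUnit (p + p₀ - 1)} :=
  (contDiffOn_obliqueProj_left p₀).add
    ((contDiffOn_const.sub contDiffOn_id).mul contDiffOn_const)

lemma contDiffOn_chartUnit (p₀ q₀ : H →L[ℂ] H) :
    ContDiffOn ℝ ∞ (fun y : (H →L[ℂ] H) × (H →L[ℂ] H) => chartUnit q₀ y.2 (chartFrame p₀ y.1))
      {y | IsUnit (y.1 + p₀ - 1)} :=
  ((contDiffOn_snd.mul ((contDiffOn_chartFrame p₀).comp contDiffOn_fst fun _ h => h)).mul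
    contDiffOn_const).add ((contDiffOn_const.sub contDiffOn_snd).mul contDiffOn_const)

/-- The domain of the chart for the third complex structure. -/
def bundleChartDomain (p₀ q₀ : H →L[ℂ] H) : Set ((H →L[ℂ] H) × (H →L[ℂ] H)) :=
  {y | IsUnit (y.1 + p₀ - 1)} ∩
    (fun y => chartUnit q₀ y.2 (chartFrame p₀ y.1)) ⁻¹' {k | IsUnit k}

/-- The chart for the third complex structure. -/
noncomputable def bundleChart (p₀ q₀ : H →L[ℂ] H) (y : (H →L[ℂ] H) × (H →L[ℂ] H)) :
    (H →L[ℂ] H) × (H →L[ℂ] H) :=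
  (obliqueProj y.1 p₀ - p₀, pullbackProj q₀ y.2 (chartFrame p₀ y.1) - q₀)

lemma isOpen_bundleChartDomain (p₀ q₀ : H →L[ℂ] H) : IsOpen (bundleChartDomain p₀ q₀) :=
  (contDiffOn_chartUnit p₀ q₀).continuousOn.isOpen_inter_preimage
    ((isOpen_isUnit_add_const p₀).preimage continuous_fst) Units.isOpen

lemma mem_bundleChartDomain_self (hp₀ : p₀ * p₀ = p₀) (hq₀ : q₀ * q₀ = q₀) :
    (p₀, q₀) ∈ bundleChartDomain p₀ q₀ := by
  refine ⟨isUnit_self_add_self_sub_one hp₀, ?_⟩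
  have h : Oblique p₀ p₀ p₀ := ⟨hp₀, hp₀, hp₀, hp₀⟩
  have e : chartUnit q₀ q₀ (chartFrame p₀ p₀) = 1 := by
    rw [chartFrame, h.obliqueProj_eq h, chartUnit, frameMap]
    linear_combination (norm := noncomm_ring) q₀ * hp₀ * q₀ + (2 : ℤ) • hq₀
  change IsUnit (chartUnit q₀ q₀ (chartFrame p₀ p₀))
  rw [e]
  exact isUnit_one

lemma contDiffOn_bundleChart (p₀ q₀ : H →L[ℂ] H) :
    ContDiffOn ℝ ∞ (bundleChart p₀ q₀) (bundleChartDomain p₀ q₀) := by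
  have hinv : ContDiffOn ℝ ∞ (Ring.inverse : (H →L[ℂ] H) → _) {k | IsUnit k} := by
    rintro _ ⟨w, rfl⟩
    exact (contDiffAt_ringInverse ℝ w).contDiffWithinAt
  have hk := hinv.comp ((contDiffOn_chartUnit p₀ q₀).mono Set.inter_subset_left)
    (fun y (hy : y ∈ bundleChartDomain p₀ q₀) => hy.2)
  exact (((contDiffOn_obliqueProj_left p₀).comp contDiffOn_fst fun _ h => h.1).sub
      contDiffOn_const).prodMk
    (((hk.mul contDiffOn_snd).mul ((contDiffOn_chartFrame p₀).comp contDiffOn_fst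
      fun _ h => h.1)).sub contDiffOn_const)

/-- The inverse of the chart for the third complex structure, together with the oblique
projections that define it. -/
noncomputable def chartInvFst (p₀ : H →L[ℂ] H) (w : (H →L[ℂ] H) × (H →L[ℂ] H)) : H →L[ℂ] H :=
  bundleProj (p₀ + leftCorner p₀ w.1)

noncomputable def chartInvFrame (p₀ : H →L[ℂ] H) (w : (H →L[ℂ] H) × (H →L[ℂ] H)) : H →L[ℂ] H :=
  frameMap p₀ (chartInvFst p₀ w) (p₀ + leftCorner p₀ w.1)

/-- Conjugation by the frame pushes the kernel of q₀ + q₀X(1 - q₀), with X = `w.2`, forward to the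
kernel wanted for q. Its range is irrelevant: `chartInvSnd` passes to the Hermitian projection with
the same kernel. -/
noncomputable def chartInvConj (p₀ q₀ : H →L[ℂ] H) (w : (H →L[ℂ] H) × (H →L[ℂ] H)) :
    H →L[ℂ] H :=
  chartInvFrame p₀ w * (q₀ + rightCorner q₀ w.2) *
    frameInv p₀ (chartInvFst p₀ w) (p₀ + leftCorner p₀ w.1)

noncomputable def chartInvSnd (p₀ q₀ : H →L[ℂ] H) (w : (H →L[ℂ] H) × (H →L[ℂ] H)) :
    H →L[ℂ] H :=
  bundleProj (star (chartInvConj p₀ q₀ w))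

lemma contDiff_chartInvFst (hp₀ : p₀ ∈ grassmannian H n) : ContDiff ℝ ∞ (chartInvFst p₀) :=
  (contDiff_bundleProj_leftCorner hp₀).comp contDiff_fst

lemma contDiff_chartInvFrame (hp₀ : p₀ ∈ grassmannian H n) : ContDiff ℝ ∞ (chartInvFrame p₀) :=
  (contDiff_const.add ((contDiff_leftCorner p₀).comp contDiff_fst)).add
    ((contDiff_const.sub (contDiff_chartInvFst hp₀)).mul contDiff_const)

lemma chartInvConj_idem (hp₀ : p₀ ∈ grassmannian H n) (hq₀ : q₀ ∈ grassmannian H n)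
    (w : (H →L[ℂ] H) × (H →L[ℂ] H)) :
    chartInvConj p₀ q₀ w * chartInvConj p₀ q₀ w = chartInvConj p₀ q₀ w := by
  have h1 := frameInv_mul_frameMap (oblique_add_leftCorner hp₀ w.1)
  have h2 := (sameRange_add_rightCorner hq₀.1.1 w.2).symm.idem
  simp only [chartInvConj, chartInvFrame, chartInvFst]
  generalize frameMap p₀ _ _ = g at *
  generalize frameInv p₀ _ _ = g' at *
  generalize q₀ + rightCorner q₀ w.2 = r at *
  linear_combination (norm := noncomm_ring) g * r * h1 * r * g' + g * h2 * g'

lemma contDiff_chartInvSnd (hp₀ : p₀ ∈ grassmannian H n) (hq₀ : q₀ ∈ grassmannian H n) :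
    ContDiff ℝ ∞ (chartInvSnd p₀ q₀) := by
  refine contDiff_bundleProj_comp (contDiff_star.comp ?_)
    fun w => star_idem (chartInvConj_idem hp₀ hq₀ w)
  exact ((contDiff_chartInvFrame hp₀).mul
    (contDiff_const.add ((contDiff_rightCorner q₀).comp contDiff_snd))).mul
    (((contDiff_const.mul (contDiff_chartInvFst hp₀)).add contDiff_const).sub
      (contDiff_const.add ((contDiff_leftCorner p₀).comp contDiff_fst)))

lemma oblique_chartInvConj (hp₀ : p₀ ∈ grassmannian H n) (hq₀ : q₀ ∈ grassmannian H n)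
    (w : (H →L[ℂ] H) × (H →L[ℂ] H)) :
    Oblique (bundleProj (chartInvConj p₀ q₀ w)) (chartInvSnd p₀ q₀ w) (chartInvConj p₀ q₀ w) :=
  oblique_bundleProj (chartInvConj_idem hp₀ hq₀ w)

lemma chartInvSnd_mem (hp₀ : p₀ ∈ grassmannian H n) (hq₀ : q₀ ∈ grassmannian H n)
    (w : (H →L[ℂ] H) × (H →L[ℂ] H)) : chartInvSnd p₀ q₀ w ∈ grassmannian H n := by
  apply bundleProj_mem
  apply star_mem_cotangentGrassmannian
  exact conj_mem_cotangentGrassmannian (frameInv_mul_frameMap (oblique_add_leftCorner hp₀ w.1))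
    ((oblique_add_rightCorner hq₀ w.2).mem hq₀)

lemma chartFrame_chartInvFst (hp₀ : p₀ ∈ grassmannian H n) (w : (H →L[ℂ] H) × (H →L[ℂ] H)) :
    obliqueProj (chartInvFst p₀ w) p₀ = p₀ + leftCorner p₀ w.1 ∧
      chartFrame p₀ (chartInvFst p₀ w) = chartInvFrame p₀ w := by
  have h := (oblique_add_leftCorner hp₀ w.1).obliqueProj_eq_of_star_eq (star_bundleProj _) hp₀.2
  exact ⟨h, by rw [chartFrame, chartInvFst, h]; rfl⟩

lemma pullbackProj_chartInv (hp₀ : p₀ ∈ grassmannian H n) (hq₀ : q₀ ∈ grassmannian H n)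
    {w : (H →L[ℂ] H) × (H →L[ℂ] H)}
    (hu : IsUnit (chartUnit q₀ (chartInvSnd p₀ q₀ w) (chartInvFrame p₀ w))) :
    pullbackProj q₀ (chartInvSnd p₀ q₀ w) (chartInvFrame p₀ w) = q₀ + rightCorner q₀ w.2 := by
  refine pullbackProj_eq (sameRange_add_rightCorner hq₀.1.1 w.2) ?_ hu
  have h1 := frameInv_mul_frameMap (oblique_add_leftCorner hp₀ w.1)
  have h2 := (oblique_chartInvConj hp₀ hq₀ w).ker_left
  generalize chartInvSnd p₀ q₀ w = q at *
  simp only [chartInvConj, chartInvFrame, chartInvFst] at *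
  generalize frameMap p₀ _ _ = g at *
  generalize frameInv p₀ _ _ = g' at *
  generalize q₀ + rightCorner q₀ w.2 = r at *
  linear_combination (norm := noncomm_ring) h2 * g - q * g * r * h1

/-- The second coordinate has the pullback of the kernel of q as its kernel. Pushing forward by g
restores the kernel of q, and a Hermitian projection is determined by its kernel. -/
lemma chartInv_bundleChart (hp₀ : p₀ ∈ grassmannian H n) (hq₀ : q₀ ∈ grassmannian H n)
    {y : (H →L[ℂ] H) × (H →L[ℂ] H)} (hy : y ∈ grassmannian H n ×ˢ grassmannian H n)
    (hyU : y ∈ bundleChartDomain p₀ q₀) :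
    (chartInvFst p₀ (bundleChart p₀ q₀ y), chartInvSnd p₀ q₀ (bundleChart p₀ q₀ y)) = y := by
  have h := oblique_of_mem hy.1 hp₀ hyU.1
  have h1 : chartInvFst p₀ (bundleChart p₀ q₀ y) = y.1 :=
    bundleProj_leftCorner_obliqueProj hp₀ hy.1 hyU.1
  have h2 : p₀ + leftCorner p₀ (bundleChart p₀ q₀ y).1 = obliqueProj y.1 p₀ := by
    rw [bundleChart, leftCorner_sub_of_oblique h hp₀.1.1, add_sub_cancel]
  have hr := sameRange_pullbackProj hq₀.1.1 hy.2.1.1 hyU.2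
  have h3 : q₀ + rightCorner q₀ (bundleChart p₀ q₀ y).2 =
      pullbackProj q₀ y.2 (chartFrame p₀ y.1) := by
    rw [bundleChart, rightCorner_sub_of_oblique
      (oblique_bundleProj_star_of_sameRange hr) hq₀.1.1, add_sub_cancel]
  have h4 := conj_pullbackProj hq₀.1.1 hy.2.1.1 hyU.2 (frameMap_mul_frameInv h)
  refine Prod.ext h1 (bundleProj_eq hy.2.2 ?_)
  rw [chartInvConj, chartInvFrame, h1, h2, h3]
  constructor
  · rw [← hy.2.2, ← star_mul]
    exact congrArg star (by rw [hy.2.2]; exact h4.2)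
  · rw [← hy.2.2, ← star_mul]
    exact congrArg star (by rw [hy.2.2]; exact h4.1)

lemma fderiv_bundleChart (hp₀ : p₀ ∈ grassmannian H n) (hq₀ : q₀ ∈ grassmannian H n) :
    ∀ y ∈ (grassmannian H n ×ˢ grassmannian H n) ∩ bundleChartDomain p₀ q₀,
      ∀ A ∈ tangentVectors (grassmannian H n ×ˢ grassmannian H n) y,
      fderiv ℝ (bundleChart p₀ q₀) y A =
        ((1 - obliqueProj y.1 p₀) * A.1 * obliqueProj y.1 p₀,
        Ring.inverse (chartUnit q₀ y.2 (chartFrame p₀ y.1)) *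
          (y.2 * (A.2 * chartFrame p₀ y.1 + y.2 * ((1 - obliqueProj y.1 p₀) * A.1 *
            obliqueProj y.1 p₀ - A.1 * (1 - p₀))) *
            (1 - pullbackProj q₀ y.2 (chartFrame p₀ y.1)))) := by
  refine fderiv_eq_of_curve (isOpen_bundleChartDomain p₀ q₀) (contDiffOn_bundleChart p₀ q₀)
    (fun y A => ((1 - obliqueProj y.1 p₀) * A.1 * obliqueProj y.1 p₀,
        Ring.inverse (chartUnit q₀ y.2 (chartFrame p₀ y.1)) *
          (y.2 * (A.2 * chartFrame p₀ y.1 + y.2 * ((1 - obliqueProj y.1 p₀) * A.1 *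
            obliqueProj y.1 p₀ - A.1 * (1 - p₀))) *
            (1 - pullbackProj q₀ y.2 (chartFrame p₀ y.1))))) ?_
  intro γ hγ hM hγU B hB
  have h := (hγ.differentiable (by simp) 0).hasDerivAt
  have h1 := (hasFDerivAt_fst (𝕜 := ℝ) (p := γ 0)).comp_hasDerivAt 0 h
  have h2 := (hasFDerivAt_snd (𝕜 := ℝ) (p := γ 0)).comp_hasDerivAt 0 h
  have hB1 := ((hasFDerivAt_fst (𝕜 := ℝ)).comp_hasDerivAt 0 hB).add_const p₀
  have hB2 := ((hasFDerivAt_snd (𝕜 := ℝ)).comp_hasDerivAt 0 hB).add_const q₀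
  have hs : HasDerivAt (fun t => obliqueProj (γ t).1 p₀) B.1 0 :=
    hB1.congr_of_eventuallyEq (.of_forall fun t => (sub_add_cancel _ p₀).symm)
  have k1 := deriv_obliqueProj h1 (hasDerivAt_const 0 p₀) (fun t => (hM t).1.1.1)
    (fun _ => hp₀.1.1) hγU.1 hs
  simp only [mul_zero, zero_mul, add_zero] at k1
  have hG : HasDerivAt (fun t => chartFrame p₀ (γ t).1) (B.1 - (deriv γ 0).1 * (1 - p₀)) 0 := by
    have := hs.add ((h1.const_sub 1).mul_const (1 - p₀))
    rwa [neg_mul, ← sub_eq_add_neg] at this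
  have k2 := deriv_pullbackProj h2 hG (fun t => (hM t).2.1.1) hq₀.1.1 hγU.2
    (hB2.congr_of_eventuallyEq (.of_forall fun t => (sub_add_cancel _ q₀).symm))
  rw [k1] at k2
  exact Prod.ext k1 k2

/-- The base coordinate is the graph coordinate of p. The fibre coordinate is that of the kernel of
q, read in the holomorphic frame of S ⊕ H/S over p. -/
lemma isComplexStructureOn_extJhat (n : ℕ) :
    IsComplexStructureOn (grassmannian H n ×ˢ grassmannian H n) extJhat where
  endField := isSmoothEndField_extJhat n
  sq x hx A hA := by
    rw [mem_tangentVectors_grassmannian_prod hx] at hA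
    exact extJhat_extJhat hx.1.1.1 hx.2.1.1 hA.1.1 hA.2.1
  integrable := by
    rintro ⟨p₀, q₀⟩ ⟨(hp₀ : p₀ ∈ _), (hq₀ : q₀ ∈ _)⟩
    have hk : Continuous (fun w => chartUnit q₀ (chartInvSnd p₀ q₀ w) (chartInvFrame p₀ w)) :=
      (((contDiff_chartInvSnd hp₀ hq₀).continuous.mul
        (contDiff_chartInvFrame hp₀).continuous).mul continuous_const).add
        ((continuous_const.sub (contDiff_chartInvSnd hp₀ hq₀).continuous).mul continuous_const)
    refine exists_complex_chart
      -- The inverse of the chart is defined for every w, but it lands in the domain of the chart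
      -- only where the chart unit at the image point is invertible.
      (V := {w | IsUnit (chartUnit q₀ (chartInvSnd p₀ q₀ w) (chartInvFrame p₀ w))})
      ((leftCorner p₀).prodMap (rightCorner q₀))
      (fun w => Prod.ext (leftCorner_leftCorner hp₀.1.1 _) (rightCorner_rightCorner hq₀.1.1 _))
      (isOpen_bundleChartDomain p₀ q₀) (mem_bundleChartDomain_self hp₀.1.1 hq₀.1.1)
      (Units.isOpen.preimage hk) (contDiffOn_bundleChart p₀ q₀)
      (g := fun w => (chartInvFst p₀ w, chartInvSnd p₀ q₀ w))
      ((contDiff_chartInvFst hp₀).prodMk (contDiff_chartInvSnd hp₀ hq₀)).contDiffOn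
      ?_ ?_ ?_ ?_ ?_ ?_
    · rintro y ⟨hy, hyU⟩
      have e := Prod.ext_iff.1 (chartInv_bundleChart hp₀ hq₀ hy hyU)
      simp only at e
      change IsUnit _
      rw [← (chartFrame_chartInvFst hp₀ _).2, e.1, e.2]
      exact hyU.2
    · rintro y ⟨hy, hyU⟩
      exact Prod.ext (leftCorner_sub_of_oblique (oblique_of_mem hy.1 hp₀ hyU.1) hp₀.1.1)
        (rightCorner_sub_of_oblique (oblique_bundleProj_star_of_sameRange
          (sameRange_pullbackProj hq₀.1.1 hy.2.1.1 hyU.2)) hq₀.1.1)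
    · intro w hw _
      have h1 := oblique_add_leftCorner hp₀ w.1
      refine ⟨⟨h1.left_mem (star_bundleProj _) hp₀, chartInvSnd_mem hp₀ hq₀ w⟩,
        h1.isUnit_of_star_eq (star_bundleProj _) hp₀.2, ?_⟩
      change IsUnit (chartUnit q₀ (chartInvSnd p₀ q₀ w) (chartFrame p₀ (chartInvFst p₀ w)))
      rw [(chartFrame_chartInvFst hp₀ w).2]
      exact hw
    · rintro y ⟨hy, hyU⟩
      exact chartInv_bundleChart hp₀ hq₀ hy hyU
    · intro w hw hT
      refine Eq.trans (Prod.ext ?_ ?_) hT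
      · exact sub_eq_of_eq_add' (chartFrame_chartInvFst hp₀ w).1
      · refine sub_eq_of_eq_add' ?_
        simp only
        rw [(chartFrame_chartInvFst hp₀ w).2]
        exact pullbackProj_chartInv hp₀ hq₀ hw
    · rintro ⟨p, q⟩ ⟨hy, hyU⟩ ⟨A, B⟩ hA
      rw [fderiv_bundleChart hp₀ hq₀ _ ⟨hy, hyU⟩ _ hA, fderiv_bundleChart hp₀ hq₀ _ ⟨hy, hyU⟩ _
        ((isSmoothEndField_extJhat n).mapsTo _ hy _ hA), extJhat_eq]
      rw [mem_tangentVectors_grassmannian_prod hy] at hA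
      have h := oblique_of_mem hy.1 hp₀ hyU.1
      refine Prod.ext (leftCorner_opJ h.sameRange) ?_
      have hr : q * chartFrame p₀ p * (1 - pullbackProj q₀ q (chartFrame p₀ p)) = 0 := by
        rw [mul_sub, mul_one, mul_pullbackProj hq₀.1.1 hy.2.1.1 hyU.2, sub_self]
      have key := frame_velocity_identity (B := B) hy.2.1.1 hy.1.1.1 hA.1.1 h rfl hr
      simp only [smul_mul_assoc, mul_smul_comm, ← smul_sub, ← smul_add, Prod.smul_mk]
      congr 2

end BundleCharts

theorem mainTheorem5 {H : Type u} [NormedAddCommGroup H] [InnerProductSpace ℂ H]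
    [CompleteSpace H] (n : ℕ) :
    -- the compactification
    IsOpenDenseEmbedding compactificationMap (cotangentGrassmannian H n)
      (grassmannian H n ×ˢ grassmannian H n) ∧
    (FiniteDimensional ℂ H → IsCompact (grassmannian H n ×ˢ grassmannian H n)) ∧
    -- the three complex structures extend
    IsComplexExtension compactificationMap (cotangentGrassmannian H n)
      (grassmannian H n ×ˢ grassmannian H n) structI extI ∧
    IsComplexExtension compactificationMap (cotangentGrassmannian H n)
      (grassmannian H n ×ˢ grassmannian H n) structJ extJ ∧
    IsComplexExtension compactificationMap (cotangentGrassmannian H n)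
      (grassmannian H n ×ˢ grassmannian H n) (structJhat n) extJhat ∧
    -- the adjoint involution of the cotangent bundle extends to a smooth involution
    Set.MapsTo star (cotangentGrassmannian H n) (cotangentGrassmannian H n) ∧
    (∃ S : (H →L[ℂ] H) × (H →L[ℂ] H) → (H →L[ℂ] H) × (H →L[ℂ] H),
      SmoothMapOn S (grassmannian H n ×ˢ grassmannian H n) ∧
      Set.MapsTo S (grassmannian H n ×ˢ grassmannian H n)
        (grassmannian H n ×ˢ grassmannian H n) ∧
      (∀ x ∈ grassmannian H n ×ˢ grassmannian H n, S (S x) = x) ∧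
      ∀ r ∈ cotangentGrassmannian H n,
        S (compactificationMap r) = compactificationMap (star r)) ∧
    -- the projections `r ↦ π(r)` and `r ↦ π(r*)` extend to smooth maps
    (∃ P : (H →L[ℂ] H) × (H →L[ℂ] H) → (H →L[ℂ] H),
      SmoothMapOn P (grassmannian H n ×ˢ grassmannian H n) ∧
      Set.MapsTo P (grassmannian H n ×ˢ grassmannian H n) (grassmannian H n) ∧
      ∀ r ∈ cotangentGrassmannian H n, P (compactificationMap r) = bundleProj r) ∧
    (∃ P : (H →L[ℂ] H) × (H →L[ℂ] H) → (H →L[ℂ] H),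
      SmoothMapOn P (grassmannian H n ×ˢ grassmannian H n) ∧
      Set.MapsTo P (grassmannian H n ×ˢ grassmannian H n) (grassmannian H n) ∧
      ∀ r ∈ cotangentGrassmannian H n,
        P (compactificationMap r) = bundleProj (star r)) := by
  have hI := isSmoothEndField_extI (H := H) n
  have hJ := isSmoothEndField_extJ (H := H) n
  have hJhat := isSmoothEndField_extJhat (H := H) n
  refine ⟨isOpenDenseEmbedding_compactificationMap n, fun _ =>
    (isCompact_grassmannian n).prod (isCompact_grassmannian n),
    ⟨isComplexStructureOn_extI n, extendsField_structI n, fun _ hK he _ hy _ hB =>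
      eq_of_extendsField hI hK (extendsField_structI n) he hy hB⟩,
    ⟨isComplexStructureOn_extJ n, extendsField_structJ n, fun _ hK he _ hy _ hB =>
      eq_of_extendsField hJ hK (extendsField_structJ n) he hy hB⟩,
    ⟨isComplexStructureOn_extJhat n, extendsField_structJhat n, fun _ hK he _ hy _ hB =>
      eq_of_extendsField hJhat hK (extendsField_structJhat n) he hy hB⟩,
    fun _ hr => star_mem_cotangentGrassmannian hr,
    ⟨Prod.swap, smoothMapOn_of_contDiff (contDiff_snd.prodMk contDiff_fst) _,
      fun _ hx => ⟨hx.2, hx.1⟩, fun _ _ => rfl, fun r _ => ?_⟩,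
    ⟨Prod.fst, smoothMapOn_of_contDiff contDiff_fst _, fun _ hx => hx.1, fun _ _ => rfl⟩,
    ⟨Prod.snd, smoothMapOn_of_contDiff contDiff_snd _, fun _ hx => hx.2, fun _ _ => rfl⟩⟩
  simp only [compactificationMap, star_star, Prod.swap]
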